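/- Let $(\mathcal X,\mathcal F,\sigma)$ be a $\sigma$-finite measure space, and let $(\mathcal F_n)_{n\in\mathbb Z}$ be an atomic filtration: an increasing sequence of sigma-algebras $\mathcal F_n\subset\mathcal F$ such that for every $n$ there is a countable collection $\mathcal D_n\subset\mathcal F_n$ of pairwise disjoint sets of finite measure with the property that every set in $\mathcal F_n$ is a union of sets in $\mathcal D_n$. An atom is a pair $(I,n)$ with $I\in\mathcal D_n$, written $I$; $n=\operatorname{rk} I$ is its rank; $\mathcal D$ is the collection of all atoms; and $I\subset J$ for atoms means that $I$ is a subset of $J$ and $\operatorname{rk} I\ge\operatorname{rk} J$. Write $|I|=\sigma(I)$ and $\langle g\rangle_I=|I|^{-1}\int_I g\,d\sigma$ for scalar-, vector- or matrix-valued $g$, with $\langle g\rangle_I=0$ if $|I|=0$; also interpret $|I|^{-1}$ as $0$ if $|I|=0$. Let $\mathbb F=\mathbb R$ or $\mathbb C$, let $W$ be a $d\times d$ matrix weight, i.e. a function on $\mathcal X$ with values in the positive semidefinite $d\times d$ matrices over $\mathbb F$ whose entries are integrable on every atom, and let $A_I$ ($I\in\mathcal D$) be positive semidefinite $d\times d$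 matrices over $\mathbb F$. Let $L^2$ be the space of measurable $f:\mathcal X\to\mathbb F^d$ with $\|f\|_{L^2}^2=\int_{\mathcal X}\|f\|^2\,d\sigma<\infty$, and $L^2(W)$ the space of measurable $f:\mathcal X\to\mathbb F^d$ with $\|f\|_{L^2(W)}^2=\int_{\mathcal X}\langle W(x)f(x),f(x)\rangle\,d\sigma(x)<\infty$. Then the following are equivalent: 1. there is a constant $A\in[0,\infty)$ such that $\sum_{I\in\mathcal D}\|A_I^{1/2}\langle W^{1/2}f\rangle_I\|^2\,|I|\le A\|f\|_{L^2}^2$ for all $f\in L^2$; 2. there is a constant $A\in[0,\infty)$ such that $\sum_{I\in\mathcal D}\|A_I^{1/2}\langle Wf\rangle_I\|^2\,|I|\le A\|f\|_{L^2(W)}^2$ for all $f\in L^2(W)$; 3. there is a constant $B\in[0,\infty)$ such that for every $I_0\in\mathcal D$ the series below converges and $$\frac1{|I_0|}\sum_{I\in\mathcal D,\ I\subset I_0}\langle W\rangle_I A_I\langle W\rangle_I\,|I|\le B\,\langle W\rangle_{I_0}$$ in the sense that the difference of the right and left sides is positive semidefinite. Moreover, if these conditions hold, then there are smallest constants $A$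 in 1, $A$ in 2 and $B$ in 3; the smallest constants in 1 and 2 are the same number $A$, and $$B\le A\le e\cdot d^3(d+1)^2\,B .$$ -/

import Mathlib

open MeasureTheory
open scoped ENNReal NNReal ComplexOrder MatrixOrder

noncomputable section

/-- An atomic filtration on the measure space `(X, σ)`: an increasing family of sub-sigma-algebras
`F n`, `n ∈ ℤ`, together with, for every `n`, a countable collection `D n` of pairwise disjoint
`F n`-measurable sets of finite measure such that every `F n`-measurable set is a union of members
of `D n`. -/
structure AtomicFiltration {X : Type*} [mX : MeasurableSpace X] (σ : Measure X) where
  F : Filtration ℤ mX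
  D : ℤ → Set (Set X)
  countable : ∀ n, (D n).Countable
  disjoint : ∀ n, (D n).PairwiseDisjoint id
  measurable : ∀ n, ∀ s ∈ D n, MeasurableSet[F n] s
  finite_measure : ∀ n, ∀ s ∈ D n, σ s < ∞
  eq_sUnion : ∀ n, ∀ s, MeasurableSet[F n] s → ∃ S ⊆ D n, s = ⋃₀ S

namespace AtomicFiltration

variable {X : Type*} [MeasurableSpace X] {σ : Measure X}

/-- An atom is a pair `(I, n)` with `I ∈ D n`: a set that belongs to several generations gives
several atoms. -/
structure Atom (𝓓 : AtomicFiltration σ) where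
  rk : ℤ
  set : Set X
  mem : set ∈ 𝓓.D rk

/-- Inclusion of atoms: inclusion of the sets together with `rk J ≤ rk I`. -/
def Atom.IsSub {𝓓 : AtomicFiltration σ} (I J : 𝓓.Atom) : Prop :=
  I.set ⊆ J.set ∧ J.rk ≤ I.rk

end AtomicFiltration

section MatrixWeight

variable {X : Type*} [MeasurableSpace X] {𝕜 : Type*} [RCLike 𝕜] {d : ℕ}

/-- A matrix weight: a function with values in the positive semidefinite matrices whose entries are
integrable on every atom. -/
structure IsMatrixWeight {σ : Measure X} (𝓓 : AtomicFiltration σ)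
    (W : X → Matrix (Fin d) (Fin d) 𝕜) : Prop where
  posSemidef : ∀ x, (W x).PosSemidef
  integrableOn : ∀ (I : 𝓓.Atom) (i j : Fin d), IntegrableOn (fun x => W x i j) I.set σ

/-- The average `⟨W⟩_I` of a matrix-valued function over the set `I`, taken entrywise. It is `0` if
`σ I = 0`. -/
def matrixAvg (σ : Measure X) (W : X → Matrix (Fin d) (Fin d) 𝕜) (I : Set X) :
    Matrix (Fin d) (Fin d) 𝕜 :=
  Matrix.of fun i j => ⨍ x in I, W x i j ∂σ

/-- The square `∫ ⟨W(x) f(x), f(x)⟩ dσ(x)` of the norm of `L²(W)`. -/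
def weightedNormSq (σ : Measure X) (W : X → Matrix (Fin d) (Fin d) 𝕜)
    (f : X → EuclideanSpace 𝕜 (Fin d)) : ℝ≥0∞ :=
  ∫⁻ x, ENNReal.ofReal (RCLike.re (inner 𝕜 ((W x).toEuclideanLin (f x)) (f x))) ∂σ

/-- Membership in `L²(W)`. -/
def MemL2Weighted (σ : Measure X) (W : X → Matrix (Fin d) (Fin d) 𝕜)
    (f : X → EuclideanSpace 𝕜 (Fin d)) : Prop :=
  AEStronglyMeasurable f σ ∧ weightedNormSq σ W f < ∞

/-- The sum `∑_I ‖A_I^{1/2} ⟨V f⟩_I‖² |I|` over all atoms, for a matrix-valued function `V`. The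
averages `⨍` over sets of measure zero are `0`. -/
def embeddingSum {σ : Measure X} (𝓓 : AtomicFiltration σ)
    (V : X → Matrix (Fin d) (Fin d) 𝕜) (A : 𝓓.Atom → Matrix (Fin d) (Fin d) 𝕜)
    (f : X → EuclideanSpace 𝕜 (Fin d)) : ℝ≥0∞ :=
  ∑' I : 𝓓.Atom,
    ‖(CFC.sqrt (A I)).toEuclideanLin (⨍ x in I.set, (V x).toEuclideanLin (f x) ∂σ)‖ₑ ^ 2 * σ I.set

/-- The embedding `∑_I ‖A_I^{1/2} ⟨W^{1/2} f⟩_I‖² |I| ≤ a ‖f‖²_{L²}` for all `f ∈ L²`. -/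
def UnweightedEmbedding {σ : Measure X} (𝓓 : AtomicFiltration σ)
    (W : X → Matrix (Fin d) (Fin d) 𝕜) (A : 𝓓.Atom → Matrix (Fin d) (Fin d) 𝕜) (a : ℝ≥0) : Prop :=
  ∀ f : X → EuclideanSpace 𝕜 (Fin d), MemLp f 2 σ →
    embeddingSum 𝓓 (fun x => CFC.sqrt (W x)) A f ≤ a * eLpNorm f 2 σ ^ 2

/-- The embedding `∑_I ‖A_I^{1/2} ⟨W f⟩_I‖² |I| ≤ a ‖f‖²_{L²(W)}` for all `f ∈ L²(W)`. -/
def WeightedEmbedding {σ : Measure X} (𝓓 : AtomicFiltration σ)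
    (W : X → Matrix (Fin d) (Fin d) 𝕜) (A : 𝓓.Atom → Matrix (Fin d) (Fin d) 𝕜) (a : ℝ≥0) : Prop :=
  ∀ f : X → EuclideanSpace 𝕜 (Fin d), MemL2Weighted σ W f →
    embeddingSum 𝓓 W A f ≤ a * weightedNormSq σ W f

/-- The matrix Carleson condition: for every atom `I₀` the series
`∑_{I ⊂ I₀} |I| ⟨W⟩_I A_I ⟨W⟩_I` converges and `|I₀|⁻¹` times its sum is at most `b ⟨W⟩_{I₀}` in the
order of Hermitian matrices (`M ≤ N` means that `N - M` is positive semidefinite). -/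
def MatrixCarleson {σ : Measure X} (𝓓 : AtomicFiltration σ)
    (W : X → Matrix (Fin d) (Fin d) 𝕜) (A : 𝓓.Atom → Matrix (Fin d) (Fin d) 𝕜) (b : ℝ≥0) : Prop :=
  ∀ I₀ : 𝓓.Atom,
    Summable (fun I : {I : 𝓓.Atom // I.IsSub I₀} =>
      σ.real I.1.set • (matrixAvg σ W I.1.set * A I.1 * matrixAvg σ W I.1.set)) ∧
    (σ.real I₀.set)⁻¹ • (∑' I : {I : 𝓓.Atom // I.IsSub I₀},
      σ.real I.1.set • (matrixAvg σ W I.1.set * A I.1 * matrixAvg σ W I.1.set)) ≤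
      (b : ℝ) • matrixAvg σ W I₀.set

end MatrixWeight

end

/-! The two embeddings are equivalent with the same constant. In one direction, substitute `W^{1/2}
f` for `f`. In the other, approximate `g` in `L²` through `f_n = (W + ε_n)⁻¹ W^{1/2} g`, for which
`W f_n → W^{1/2} g`, and use lower semicontinuity of the sum. Testing on `1_{I₀} W^{1/2} v` gives
the Carleson condition with `B ≤ A`.

The substance is the passage from Carleson to embedding. Put `S_I = ∑_{J ⊂ I} |J| ⟨W⟩_J A_J ⟨W⟩_J`
and `f_I = ⟨W^{1/2} g⟩_I`, and for `s ≥ 0` let `z_s` solve `(⟨W⟩_I + ε + s κ |I|⁻¹ S_I) z_s = f_I`.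
The Bellman function `|I| ⟨f_I, z_s⟩` lies between `0` and `∫_I ‖g‖²`. From an atom to its children
it grows by at least `s κ |I| ‖A_I^{1/2} ⟨W⟩_I z_s‖²` (`bellman_step`), so these gains sum to at
most `‖g‖²` (`tsum_gain_le`).

What is wanted is the same bound at `s = 0`, where the gain degenerates. Diagonalising the pencil
(`Matrix.PosDef.exists_pencil_solution`) writes `z_s = ∑ (1 + s μ_i)⁻¹ e_i`, where the Carleson
condition and `κ = 1/(2dB)` give `0 ≤ μ_i ≤ 1/(2d)`. After multiplication by `∏ (1 + s μ_i)`, whose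
square is at most `e`, this is a polynomial of degree less than `d`. Its value at `0` is controlled
by its norm in `L²([0, 1], s ds)` through the reproducing kernel, with `K(0, 0) = d²(d+1)²/2`
(`norm_sum_sq_le_integral`). Integrating the gain estimate in `s` gives `e · d²(d+1)²/2 · 2dB`;
finally `ε → 0`. -/

/-! ### Polynomials of bounded degree in `L²([0, 1], s ds)`. -/

open Polynomial in
/-- The coefficients of the reproducing kernel at `0` of the polynomials of degree less than `d` in
`L²([0, 1], s ds)`. -/
theorem exists_reproducing_coeff (d : ℕ) (hd : 0 < d) :
    ∃ c : ℕ → ℝ, (∀ i < d, ∑ j ∈ Finset.range d, c j / (i + j + 2) = if i = 0 then 1 else 0) ∧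
      c 0 = (d : ℝ) ^ 2 * ((d : ℝ) + 1) ^ 2 / 2 := by
  classical
  set v : ℕ → ℝ := fun j => -((j : ℝ) + 2) with hv
  have hvinj : Function.Injective v := by
    intro a b h
    simp only [hv] at h
    exact_mod_cast (by linarith : (a : ℝ) = b)
  -- The linear system has the Cauchy matrix `1/(i+j+2)`. It is solved by partial fractions of `N(x)
  -- / ∏ (x + j + 2)`: the numerator vanishes at `1, …, d-1`, and a scalar normalises the value at
  -- `0`.
  set N : ℝ[X] := ∏ i ∈ Finset.range (d - 1), (X - C ((i : ℝ) + 1)) with hN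
  have hNdeg : N.degree < ((Finset.range d).card : WithBot ℕ) := by
    rw [hN, Polynomial.degree_prod]
    simp only [Polynomial.degree_X_sub_C]
    simp only [Finset.sum_const, Finset.card_range, nsmul_eq_mul, mul_one]
    exact_mod_cast (by omega : d - 1 < d)
  have hNI := Lagrange.eq_interpolate (s := Finset.range d) (v := v) (f := N) hvinj.injOn hNdeg
  have hnode (i : ℕ) : (Lagrange.nodal (Finset.range d) v).eval (i : ℝ) ≠ 0 := by
    rw [Lagrange.eval_nodal, Finset.prod_ne_zero_iff]
    intro j _
    simp only [hv]
    have : (0 : ℝ) < (i : ℝ) - -((j : ℝ) + 2) := by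
      have := Nat.cast_nonneg (α := ℝ) i
      have := Nat.cast_nonneg (α := ℝ) j
      linarith
    exact this.ne'
  have key (i : ℕ) : N.eval (i : ℝ) = (Lagrange.nodal (Finset.range d) v).eval (i : ℝ) *
      ∑ j ∈ Finset.range d, Lagrange.nodalWeight (Finset.range d) v j * N.eval (v j) /
        (i + j + 2) := by
    conv_lhs => rw [hNI]
    rw [Lagrange.eval_interpolate_not_at_node]
    · congr 1
      refine Finset.sum_congr rfl fun j _ => ?_
      have : (i : ℝ) - v j = i + j + 2 := by simp only [hv]; ring
      rw [this]
      ring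
    · intro j _
      have := Nat.cast_nonneg (α := ℝ) i
      have := Nat.cast_nonneg (α := ℝ) j
      simp only [hv]
      intro h
      linarith
  set κ : ℝ := (Lagrange.nodal (Finset.range d) v).eval 0 / N.eval 0 with hκ
  have hfac (n : ℕ) : (∏ i ∈ Finset.range n, ((i : ℝ) + 1)) = n.factorial := by
    rw [← Finset.prod_range_add_one_eq_factorial]
    push_cast
    rfl
  have hfac2 (n : ℕ) : (∏ i ∈ Finset.range n, ((i : ℝ) + 2)) = (n + 1).factorial := by
    rw [← hfac (n + 1), Finset.prod_range_succ']
    simp only [Nat.cast_zero, zero_add, mul_one]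
    refine Finset.prod_congr rfl fun i _ => ?_
    push_cast
    ring
  have hfac3 (n : ℕ) : (∏ i ∈ Finset.range n, ((i : ℝ) + 3)) = (n + 2).factorial / 2 := by
    have := hfac2 (n + 1)
    rw [Finset.prod_range_succ'] at this
    rw [← this]
    simp only [Nat.cast_zero, zero_add]
    rw [mul_div_assoc, div_self two_ne_zero, mul_one]
    refine Finset.prod_congr rfl fun i _ => ?_
    push_cast
    ring
  have hN0 : N.eval 0 = (-1) ^ (d - 1) * ((d - 1).factorial : ℝ) := by
    rw [hN, Polynomial.eval_prod, ← hfac]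
    simp only [eval_sub, eval_X, eval_C, zero_sub]
    rw [Finset.prod_neg, Finset.card_range]
  have hN0' : N.eval 0 ≠ 0 := by
    rw [hN0]
    positivity
  have hnod0 : (Lagrange.nodal (Finset.range d) v).eval 0 = ((d + 1).factorial : ℝ) := by
    rw [Lagrange.eval_nodal, ← hfac2]
    refine Finset.prod_congr rfl fun i _ => ?_
    simp only [hv]
    ring
  refine ⟨fun j => κ * (Lagrange.nodalWeight (Finset.range d) v j * N.eval (v j)), ?_, ?_⟩
  · intro i hi
    have h1 : ∑ j ∈ Finset.range d,
        κ * (Lagrange.nodalWeight (Finset.range d) v j * N.eval (v j)) / (i + j + 2) =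
        κ * (N.eval (i : ℝ) / (Lagrange.nodal (Finset.range d) v).eval (i : ℝ)) := by
      rw [key i, mul_div_cancel_left₀ _ (hnode i), Finset.mul_sum]
      refine Finset.sum_congr rfl fun j _ => ?_
      ring
    rw [h1]
    split_ifs with h
    · subst h
      have := hnode 0
      simp only [Nat.cast_zero] at this ⊢
      rw [hκ]
      field_simp
    · have : N.eval (i : ℝ) = 0 := by
        rw [hN, Polynomial.eval_prod]
        refine Finset.prod_eq_zero (i := i - 1) (by simp; omega) ?_
        simp only [eval_sub, eval_X, eval_C]
        rw [Nat.cast_sub (by omega)]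
        push_cast
        ring
      rw [this]
      simp
  · have hw : Lagrange.nodalWeight (Finset.range d) v 0 = 1 / ((d - 1).factorial : ℝ) := by
      have : (Finset.range d).erase 0 = (Finset.range (d - 1)).image (· + 1) := by
        ext a
        simp only [Finset.mem_erase, Finset.mem_range, Finset.mem_image]
        constructor
        · rintro ⟨h1, h2⟩
          exact ⟨a - 1, by omega, by omega⟩
        · rintro ⟨b, h1, h2⟩
          omega
      rw [Lagrange.nodalWeight, this, Finset.prod_image (by intro a _ b _ h; simpa using h),
        ← hfac, one_div, ← Finset.prod_inv_distrib]
      refine Finset.prod_congr rfl fun i _ => congrArg _ ?_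
      simp only [hv]
      push_cast
      ring
    have hNv : N.eval (v 0) = (-1) ^ (d - 1) * ((d + 1).factorial : ℝ) / 2 := by
      rw [hN, Polynomial.eval_prod]
      have : d + 1 = (d - 1) + 2 := by omega
      rw [this, mul_div_assoc, ← hfac3]
      have hneg := Finset.prod_neg (s := Finset.range (d - 1)) (f := fun i : ℕ => (i : ℝ) + 3)
      rw [Finset.card_range] at hneg
      rw [← hneg]
      refine Finset.prod_congr rfl fun i _ => ?_
      simp only [eval_sub, eval_X, eval_C, hv]
      push_cast
      ring
    simp only
    rw [hw, hNv, hκ, hnod0, hN0]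
    obtain ⟨m, rfl⟩ : ∃ m, d = m + 1 := ⟨d - 1, by omega⟩
    simp only [Nat.add_sub_cancel]
    have h1 : ((m + 1 + 1).factorial : ℝ) = ((m : ℝ) + 2) * (m + 1) * m.factorial := by
      rw [Nat.factorial_succ, Nat.factorial_succ]
      push_cast
      ring
    have h2 : (m.factorial : ℝ) ≠ 0 := by positivity
    have h3 : ((-1 : ℝ) ^ m) * (-1) ^ m = 1 := by
      rw [← mul_pow]
      simp
    have h4 : ((-1 : ℝ) ^ m) ≠ 0 := by positivity
    rw [h1]
    push_cast
    field_simp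
    ring

/-- The reproducing property in `L²([0, 1], s ds)`. -/
theorem integral_mul_reproducing (d : ℕ) {c : ℕ → ℝ}
    (hc : ∀ i < d, ∑ j ∈ Finset.range d, c j / (i + j + 2) = if i = 0 then 1 else 0)
    (q : Polynomial ℝ) (hq : q.natDegree < d) :
    ∫ s in (0 : ℝ)..1, s * (∑ j ∈ Finset.range d, c j * s ^ j) * q.eval s = q.eval 0 := by
  have h1 (s : ℝ) : s * (∑ j ∈ Finset.range d, c j * s ^ j) * q.eval s =
      ∑ i ∈ Finset.range d, ∑ j ∈ Finset.range d, q.coeff i * c j * s ^ (i + j + 1) := by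
    rw [Polynomial.eval_eq_sum_range' hq, Finset.mul_sum]
    refine Finset.sum_congr rfl fun i _ => ?_
    rw [Finset.mul_sum, Finset.sum_mul]
    refine Finset.sum_congr rfl fun j _ => ?_
    ring
  simp_rw [h1]
  rw [intervalIntegral.integral_finsetSum
    (fun i _ => Continuous.intervalIntegrable (by fun_prop) _ _)]
  have h2 (i : ℕ) (hi : i ∈ Finset.range d) :
      ∫ s in (0 : ℝ)..1, ∑ j ∈ Finset.range d, q.coeff i * c j * s ^ (i + j + 1) =
        q.coeff i * if i = 0 then 1 else 0 := by
    rw [intervalIntegral.integral_finsetSum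
      (fun j _ => Continuous.intervalIntegrable (by fun_prop) _ _), ← hc i (by simpa using hi),
      Finset.mul_sum]
    refine Finset.sum_congr rfl fun j _ => ?_
    rw [intervalIntegral.integral_const_mul, integral_pow]
    push_cast
    simp only [one_pow, ne_eq, Nat.add_eq_zero_iff, one_ne_zero, and_false, not_false_eq_true,
      zero_pow, sub_zero]
    rw [show (i : ℝ) + j + 1 + 1 = i + j + 2 by ring]
    ring
  rw [Finset.sum_congr rfl h2, Polynomial.eval_eq_sum_range' hq]
  refine Finset.sum_congr rfl fun i _ => ?_
  by_cases h : i = 0 <;> simp [h]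

/-- Each factor is at most `exp (1/(2d))`, so the square of the product of `d` factors is at most
`e`. -/
theorem prod_one_add_mul_sq_le {d : ℕ} {μ : Fin d → ℝ} (h0 : ∀ i, 0 ≤ μ i)
    (h1 : ∀ i, μ i ≤ 1 / (2 * d)) {s : ℝ} (hs : s ∈ Set.Icc (0 : ℝ) 1) :
    (∏ i, (1 + s * μ i)) ^ 2 ≤ Real.exp 1 := by
  rcases Nat.eq_zero_or_pos d with rfl | hd
  · simp
  have hd' : (0 : ℝ) < d := by exact_mod_cast hd
  have h2 : ∏ i, (1 + s * μ i) ≤ ∏ _i : Fin d, Real.exp (1 / (2 * d)) := by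
    refine Finset.prod_le_prod (fun i _ => ?_) fun i _ => ?_
    · have := mul_nonneg hs.1 (h0 i)
      linarith
    · have h3 : s * μ i ≤ 1 / (2 * d) :=
        (mul_le_of_le_one_left (h0 i) hs.2).trans (h1 i)
      linarith [Real.add_one_le_exp (1 / (2 * (d : ℝ)))]
  have h3 : 0 ≤ ∏ i, (1 + s * μ i) := Finset.prod_nonneg fun i _ => by
    have := mul_nonneg hs.1 (h0 i)
    linarith
  refine (pow_le_pow_left₀ h3 h2 2).trans (le_of_eq ?_)
  rw [Finset.prod_const, Finset.card_univ, Fintype.card_fin, ← Real.exp_nat_mul,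
    ← Real.exp_nat_mul]
  congr 1
  push_cast
  field_simp

/-- A value at `0` of a sum of simple fractions is controlled by its mean square on `[0, 1]`. -/
theorem norm_sum_sq_le_integral {𝕜 E : Type*} [RCLike 𝕜] [NormedAddCommGroup E]
    [InnerProductSpace 𝕜 E] {d : ℕ} (c : Fin d → E) {μ : Fin d → ℝ} (h0 : ∀ i, 0 ≤ μ i)
    (h1 : ∀ i, μ i ≤ 1 / (2 * d)) :
    ‖∑ i, c i‖ ^ 2 ≤ Real.exp 1 * ((d : ℝ) ^ 2 * ((d : ℝ) + 1) ^ 2 / 2) *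
      ∫ s in (0 : ℝ)..1, s * ‖∑ i, (((1 + s * μ i)⁻¹ : ℝ) : 𝕜) • c i‖ ^ 2 := by
  rcases Nat.eq_zero_or_pos d with rfl | hd
  · simp
  have hd' : (0 : ℝ) < d := by exact_mod_cast hd
  obtain ⟨k, hk, hk0⟩ := exists_reproducing_coeff d hd
  set K : ℝ := (d : ℝ) ^ 2 * ((d : ℝ) + 1) ^ 2 / 2 with hK
  have hKpos : 0 < K := by positivity
  set w : E := ∑ i, c i with hw
  set ker : ℝ → ℝ := fun s => ∑ j ∈ Finset.range d, k j * s ^ j with hker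
  have hkerc : Continuous ker := by fun_prop
  -- Clearing denominators in `Re ⟨w, y(s)⟩`: each summand lacks one of the `d` linear factors,
  -- hence degree less than `d`.
  set q : Polynomial ℝ := ∑ i, Polynomial.C (RCLike.re (inner 𝕜 w (c i))) *
    ∏ j ∈ Finset.univ.erase i, (1 + Polynomial.C (μ j) * Polynomial.X) with hq
  have hqdeg : q.natDegree < d := by
    have : q.natDegree ≤ d - 1 := by
      refine Polynomial.natDegree_sum_le_of_forall_le _ _ fun i _ => ?_
      refine (Polynomial.natDegree_C_mul_le _ _).trans ?_
      refine (Polynomial.natDegree_prod_le _ _).trans ?_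
      refine (Finset.sum_le_card_nsmul _ _ 1 fun j _ => ?_).trans ?_
      · compute_degree
      · simp
    omega
  have hqe (s : ℝ) : q.eval s = ∑ i, RCLike.re (inner 𝕜 w (c i)) *
      ∏ j ∈ Finset.univ.erase i, (1 + s * μ j) := by
    simp only [hq, Polynomial.eval_finsetSum, Polynomial.eval_mul, Polynomial.eval_C,
      Polynomial.eval_prod, Polynomial.eval_add, Polynomial.eval_one, Polynomial.eval_X]
    simp only [mul_comm s]
  have hq0 : q.eval 0 = ‖w‖ ^ 2 := by
    rw [hqe]
    simp only [zero_mul, add_zero, Finset.prod_const_one, mul_one]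
    rw [← map_sum, ← inner_sum, ← hw, inner_self_eq_norm_sq]
  set y : ℝ → E := fun s => ∑ i, (((1 + s * μ i)⁻¹ : ℝ) : 𝕜) • c i with hy
  set P : ℝ → ℝ := fun s => ∏ i, (1 + s * μ i) with hP
  have hpos {s : ℝ} (hs : s ∈ Set.Icc (0 : ℝ) 1) (i : Fin d) : 0 < 1 + s * μ i := by
    have := mul_nonneg hs.1 (h0 i)
    linarith
  have hqy {s : ℝ} (hs : s ∈ Set.Icc (0 : ℝ) 1) : q.eval s = P s * RCLike.re (inner 𝕜 w (y s)) := by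
    rw [hqe, hy]
    simp only [inner_sum, inner_smul_right, map_sum, RCLike.re_ofReal_mul, Finset.mul_sum]
    refine Finset.sum_congr rfl fun i _ => ?_
    have : P s = (1 + s * μ i) * ∏ j ∈ Finset.univ.erase i, (1 + s * μ j) :=
      (Finset.mul_prod_erase _ _ (Finset.mem_univ i)).symm
    rw [this]
    have := (hpos hs i).ne'
    field_simp
  have hycont : ContinuousOn y (Set.Icc 0 1) := by
    refine continuousOn_finsetSum _ fun i _ => ContinuousOn.smul ?_ continuousOn_const
    refine RCLike.continuous_ofReal.comp_continuousOn ?_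
    refine ContinuousOn.inv₀ (by fun_prop) fun s hs => (hpos hs i).ne'
  -- Expansion of `0 ≤ ‖P(s) y(s) - (ker(s)/K) w‖²` with `P(s)² ≤ e`. Integrated against `s ds`, the
  -- reproducing property turns the left side into `2‖w‖²/K - ‖w‖²/K`.
  have hpt {s : ℝ} (hs : s ∈ Set.Icc (0 : ℝ) 1) :
      2 / K * (s * ker s * q.eval s) - ‖w‖ ^ 2 / K ^ 2 * (s * ker s * ker s) ≤
        Real.exp 1 * (s * ‖y s‖ ^ 2) := by
    have h2 : 0 ≤ ‖((P s : ℝ) : 𝕜) • y s - ((ker s / K : ℝ) : 𝕜) • w‖ ^ 2 := by positivity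
    rw [norm_sub_sq (𝕜 := 𝕜), inner_smul_left, inner_smul_right, norm_smul, norm_smul,
      RCLike.conj_ofReal, RCLike.re_ofReal_mul, RCLike.re_ofReal_mul, inner_re_symm,
      RCLike.norm_ofReal, RCLike.norm_ofReal, mul_pow, mul_pow, sq_abs, sq_abs] at h2
    have h3 := prod_one_add_mul_sq_le h0 h1 hs
    have h4 : P s ^ 2 * ‖y s‖ ^ 2 ≤ Real.exp 1 * ‖y s‖ ^ 2 :=
      mul_le_mul_of_nonneg_right h3 (by positivity)
    have h5 : 2 / K * (ker s * q.eval s) - ‖w‖ ^ 2 / K ^ 2 * (ker s * ker s) ≤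
        Real.exp 1 * ‖y s‖ ^ 2 := by
      rw [hqy hs]
      refine le_trans ?_ h4
      have e1 : 2 / K * (ker s * (P s * RCLike.re (inner 𝕜 w (y s)))) =
        2 * (P s * (ker s / K * RCLike.re (inner 𝕜 w (y s)))) := by ring
      have e2 : ‖w‖ ^ 2 / K ^ 2 * (ker s * ker s) = (ker s / K) ^ 2 * ‖w‖ ^ 2 := by field_simp
      rw [e1, e2]
      linarith
    have h6 := mul_le_mul_of_nonneg_left h5 hs.1
    calc _ = s * (2 / K * (ker s * q.eval s) - ‖w‖ ^ 2 / K ^ 2 * (ker s * ker s)) := by ring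
      _ ≤ _ := h6
      _ = _ := by ring
  set kp : Polynomial ℝ := ∑ j ∈ Finset.range d, Polynomial.C (k j) * Polynomial.X ^ j with hkp
  have hkpe (s : ℝ) : kp.eval s = ker s := by
    simp [hkp, hker, Polynomial.eval_finsetSum]
  have hkpdeg : kp.natDegree < d := by
    have : kp.natDegree ≤ d - 1 := by
      refine Polynomial.natDegree_sum_le_of_forall_le _ _ fun j hj => ?_
      refine (Polynomial.natDegree_C_mul_X_pow_le _ _).trans ?_
      have := Finset.mem_range.1 hj
      omega
    omega
  have hi1 := integral_mul_reproducing d hk q hqdeg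
  have hi2 := integral_mul_reproducing d hk kp hkpdeg
  have hker0 : ker 0 = K := by
    rw [← hk0]
    simp only [hker]
    rw [Finset.sum_eq_single 0]
    · simp
    · intro b _ hb
      simp [hb]
    · intro h
      exact absurd (Finset.mem_range.2 hd) h
  simp only [hkpe] at hi2
  have hqc : Continuous fun s => q.eval s := q.continuous
  have hint := intervalIntegral.integral_mono_on (μ := volume) (zero_le_one (α := ℝ))
    (f := fun s => 2 / K * (s * ker s * q.eval s) - ‖w‖ ^ 2 / K ^ 2 * (s * ker s * ker s))
    (g := fun s => Real.exp 1 * (s * ‖y s‖ ^ 2))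
    (Continuous.intervalIntegrable (by fun_prop) _ _)
    (ContinuousOn.intervalIntegrable (by
      rw [Set.uIcc_of_le zero_le_one]
      fun_prop)) fun s hs => hpt hs
  rw [intervalIntegral.integral_sub (Continuous.intervalIntegrable (by fun_prop) _ _)
    (Continuous.intervalIntegrable (by fun_prop) _ _), intervalIntegral.integral_const_mul,
    intervalIntegral.integral_const_mul, intervalIntegral.integral_const_mul] at hint
  simp only [hker] at hi1 hi2 hint hker0
  rw [hi1, hi2, hq0, hker0] at hint
  have e : 2 / K * ‖w‖ ^ 2 - ‖w‖ ^ 2 / K ^ 2 * K = ‖w‖ ^ 2 / K := by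
    field_simp
    ring
  rw [e, div_le_iff₀ hKpos] at hint
  linarith

/-! ### Quadratic forms, regularised inverses and matrix pencils. -/

section QuadForm

variable {𝕜 : Type*} [RCLike 𝕜] {d : ℕ}

/-- The quadratic form `⟨M v, v⟩` of a matrix. -/
def quadForm (M : Matrix (Fin d) (Fin d) 𝕜) (v : EuclideanSpace 𝕜 (Fin d)) : ℝ :=
  RCLike.re (inner 𝕜 (M.toEuclideanLin v) v)

theorem toEuclideanLin_mul_apply (M N : Matrix (Fin d) (Fin d) 𝕜)
    (v : EuclideanSpace 𝕜 (Fin d)) :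
    (M * N).toEuclideanLin v = M.toEuclideanLin (N.toEuclideanLin v) := by
  simp [Matrix.toLpLin_apply]

theorem toEuclideanLin_one_apply (v : EuclideanSpace 𝕜 (Fin d)) :
    (1 : Matrix (Fin d) (Fin d) 𝕜).toEuclideanLin v = v := by
  simp

theorem toEuclideanLin_real_smul_apply (r : ℝ) (M : Matrix (Fin d) (Fin d) 𝕜)
    (v : EuclideanSpace 𝕜 (Fin d)) :
    (r • M).toEuclideanLin v = (r : 𝕜) • M.toEuclideanLin v := by
  rw [RCLike.real_smul_eq_coe_smul (K := 𝕜), map_smul, LinearMap.smul_apply]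

theorem toEuclideanLin_add_apply (M N : Matrix (Fin d) (Fin d) 𝕜)
    (v : EuclideanSpace 𝕜 (Fin d)) :
    (M + N).toEuclideanLin v = M.toEuclideanLin v + N.toEuclideanLin v := by
  rw [map_add, LinearMap.add_apply]

theorem Matrix.IsHermitian.inner_toEuclideanLin_left {M : Matrix (Fin d) (Fin d) 𝕜}
    (hM : M.IsHermitian) (v w : EuclideanSpace 𝕜 (Fin d)) :
    inner 𝕜 (M.toEuclideanLin v) w = inner 𝕜 v (M.toEuclideanLin w) :=
  Matrix.isSymmetric_toEuclideanLin_iff.2 hM v w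

theorem quadForm_add (M N : Matrix (Fin d) (Fin d) 𝕜) (v : EuclideanSpace 𝕜 (Fin d)) :
    quadForm (M + N) v = quadForm M v + quadForm N v := by
  rw [quadForm, toEuclideanLin_add_apply, inner_add_left, map_add, quadForm, quadForm]

theorem quadForm_smul (r : ℝ) (M : Matrix (Fin d) (Fin d) 𝕜) (v : EuclideanSpace 𝕜 (Fin d)) :
    quadForm (r • M) v = r * quadForm M v := by
  rw [quadForm, toEuclideanLin_real_smul_apply, inner_smul_left, RCLike.conj_ofReal,
    RCLike.re_ofReal_mul, quadForm]

theorem quadForm_one (v : EuclideanSpace 𝕜 (Fin d)) :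
    quadForm (1 : Matrix (Fin d) (Fin d) 𝕜) v = ‖v‖ ^ 2 := by
  rw [quadForm, toEuclideanLin_one_apply, inner_self_eq_norm_sq]

theorem quadForm_real_smul_right (M : Matrix (Fin d) (Fin d) 𝕜) (r : ℝ)
    (v : EuclideanSpace 𝕜 (Fin d)) : quadForm M ((r : 𝕜) • v) = r ^ 2 * quadForm M v := by
  rw [quadForm, map_smul, inner_smul_left, inner_smul_right, RCLike.conj_ofReal,
    RCLike.re_ofReal_mul, RCLike.re_ofReal_mul, quadForm]
  ring

theorem Matrix.PosSemidef.quadForm_nonneg {M : Matrix (Fin d) (Fin d) 𝕜} (hM : M.PosSemidef)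
    (v : EuclideanSpace 𝕜 (Fin d)) : 0 ≤ quadForm M v :=
  (Matrix.isPositive_toEuclideanLin_iff.2 hM).2 v

theorem posSemidef_of_quadForm_nonneg {M : Matrix (Fin d) (Fin d) 𝕜} (hM : M.IsHermitian)
    (h : ∀ v, 0 ≤ quadForm M v) : M.PosSemidef :=
  Matrix.isPositive_toEuclideanLin_iff.1 ⟨Matrix.isSymmetric_toEuclideanLin_iff.2 hM, h⟩

theorem le_iff_quadForm_le {M N : Matrix (Fin d) (Fin d) 𝕜} (hM : M.IsHermitian)
    (hN : N.IsHermitian) : M ≤ N ↔ ∀ v, quadForm M v ≤ quadForm N v := by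
  have h (v : EuclideanSpace 𝕜 (Fin d)) : quadForm (N - M) v = quadForm N v - quadForm M v := by
    have := quadForm_add (N - M) M v
    rw [sub_add_cancel] at this
    linarith
  rw [Matrix.le_iff]
  constructor
  · intro hp v
    have := hp.quadForm_nonneg v
    rw [h] at this
    linarith
  · intro hv
    refine posSemidef_of_quadForm_nonneg (hN.sub hM) fun v => ?_
    rw [h]
    linarith [hv v]

theorem sqrt_isHermitian (M : Matrix (Fin d) (Fin d) 𝕜) : (CFC.sqrt M).IsHermitian :=
  (Matrix.nonneg_iff_posSemidef.1 (CFC.sqrt_nonneg M)).isHermitian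

theorem Matrix.PosSemidef.sqrt_mul_sqrt {M : Matrix (Fin d) (Fin d) 𝕜} (hM : M.PosSemidef) :
    CFC.sqrt M * CFC.sqrt M = M :=
  CFC.sqrt_mul_sqrt_self M hM.nonneg

theorem Matrix.PosSemidef.norm_sqrt_sq {M : Matrix (Fin d) (Fin d) 𝕜} (hM : M.PosSemidef)
    (v : EuclideanSpace 𝕜 (Fin d)) : ‖(CFC.sqrt M).toEuclideanLin v‖ ^ 2 = quadForm M v := by
  rw [← inner_self_eq_norm_sq (𝕜 := 𝕜), ← (sqrt_isHermitian M).inner_toEuclideanLin_left,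
    ← toEuclideanLin_mul_apply, hM.sqrt_mul_sqrt, quadForm]

theorem quadForm_conj {V A : Matrix (Fin d) (Fin d) 𝕜} (hV : V.IsHermitian) (hA : A.PosSemidef)
    (v : EuclideanSpace 𝕜 (Fin d)) :
    quadForm (V * A * V) v = ‖(CFC.sqrt A).toEuclideanLin (V.toEuclideanLin v)‖ ^ 2 := by
  rw [hA.norm_sqrt_sq, quadForm, toEuclideanLin_mul_apply, toEuclideanLin_mul_apply,
    hV.inner_toEuclideanLin_left, quadForm]

/-- The variational characterisation of `⟨T⁻¹ f, f⟩`. -/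
theorem Matrix.PosSemidef.two_mul_re_inner_le {T : Matrix (Fin d) (Fin d) 𝕜} (hT : T.PosSemidef)
    {z f : EuclideanSpace 𝕜 (Fin d)} (hz : T.toEuclideanLin z = f)
    (v : EuclideanSpace 𝕜 (Fin d)) :
    2 * RCLike.re (inner 𝕜 f v) ≤ RCLike.re (inner 𝕜 f z) + quadForm T v := by
  have h := hT.quadForm_nonneg (v - z)
  have h1 : inner 𝕜 (T.toEuclideanLin v) z = inner 𝕜 v f := by
    rw [hT.isHermitian.inner_toEuclideanLin_left, hz]
  rw [quadForm, map_sub, inner_sub_left, inner_sub_right, inner_sub_right, hz, h1, map_sub,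
    map_sub, map_sub, inner_re_symm v f] at h
  rw [quadForm]
  linarith

/-- If `|⟨f, v⟩|² ≤ G ⟨V v, v⟩` for all `v`, in the dual form, then `z = (V + ε)⁻¹ f` satisfies
`4 ε ‖z‖² ≤ G`. -/
theorem mul_norm_sq_le_of_regularized {V : Matrix (Fin d) (Fin d) 𝕜}
    {f z : EuclideanSpace 𝕜 (Fin d)} {G ε : ℝ}
    (h : ∀ v, 2 * RCLike.re (inner 𝕜 f v) ≤ G + quadForm V v)
    (hz : (V + ε • (1 : Matrix (Fin d) (Fin d) 𝕜)).toEuclideanLin z = f) :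
    4 * ε * ‖z‖ ^ 2 ≤ G := by
  have h1 : RCLike.re (inner 𝕜 f z) = quadForm V z + ε * ‖z‖ ^ 2 := by
    rw [← hz, ← quadForm_one (𝕜 := 𝕜), ← quadForm_smul, ← quadForm_add]
    rfl
  -- The test vector `2z` makes the two multiples of `⟨V z, z⟩` cancel.
  have h2 := h (((2 : ℝ) : 𝕜) • z)
  rw [quadForm_real_smul_right, inner_smul_right, RCLike.re_ofReal_mul, h1] at h2
  nlinarith

/-- Testing the dual inequality at `v = z` itself suffices. Applied pointwise, this bounds the
`L²(W)` norm of the approximants `f_n`. -/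
theorem quadForm_le_of_regularized {V : Matrix (Fin d) (Fin d) 𝕜}
    {f z : EuclideanSpace 𝕜 (Fin d)} {G ε : ℝ} (hε : 0 ≤ ε)
    (h : ∀ v, 2 * RCLike.re (inner 𝕜 f v) ≤ G + quadForm V v)
    (hz : (V + ε • (1 : Matrix (Fin d) (Fin d) 𝕜)).toEuclideanLin z = f) :
    quadForm V z ≤ G := by
  have h1 : RCLike.re (inner 𝕜 f z) = quadForm V z + ε * ‖z‖ ^ 2 := by
    rw [← hz, ← quadForm_one (𝕜 := 𝕜), ← quadForm_smul, ← quadForm_add]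
    rfl
  have h2 := h z
  rw [h1] at h2
  have : 0 ≤ ε * ‖z‖ ^ 2 := by positivity
  linarith

/-- The error is exactly `ε z`, and `ε ‖z‖²` is bounded by the previous estimate. Hence `V z → f` as
`ε → 0` even for singular `V`, with no explicit pseudo-inverse. -/
theorem norm_sub_sq_le_of_regularized {V : Matrix (Fin d) (Fin d) 𝕜}
    {f z : EuclideanSpace 𝕜 (Fin d)} {G ε : ℝ} (hε : 0 ≤ ε)
    (h : ∀ v, 2 * RCLike.re (inner 𝕜 f v) ≤ G + quadForm V v)
    (hz : (V + ε • (1 : Matrix (Fin d) (Fin d) 𝕜)).toEuclideanLin z = f) :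
    ‖f - V.toEuclideanLin z‖ ^ 2 ≤ ε * G := by
  have h1 : f - V.toEuclideanLin z = (ε : 𝕜) • z := by
    rw [← hz, toEuclideanLin_add_apply, toEuclideanLin_real_smul_apply, toEuclideanLin_one_apply]
    abel
  rw [h1, norm_smul, mul_pow, RCLike.norm_ofReal, sq_abs]
  have h2 := mul_norm_sq_le_of_regularized h hz
  have h3 : 0 ≤ ε * ‖z‖ ^ 2 := by positivity
  nlinarith

/-- Simultaneous diagonalisation of a pencil `T + s M`: a formula for `(T + s M)⁻¹ f`. -/
theorem Matrix.PosDef.exists_pencil_solution {T M : Matrix (Fin d) (Fin d) 𝕜} (hT : T.PosDef)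
    (hM : M.PosSemidef) {κ : ℝ} (hMT : ∀ v, quadForm M v ≤ κ * quadForm T v)
    (f : EuclideanSpace 𝕜 (Fin d)) :
    ∃ (e : Fin d → EuclideanSpace 𝕜 (Fin d)) (μ : Fin d → ℝ), (∀ i, 0 ≤ μ i) ∧ (∀ i, μ i ≤ κ) ∧
      ∀ s : ℝ, 0 ≤ s →
        (T + s • M).toEuclideanLin (∑ i, (((1 + s * μ i)⁻¹ : ℝ) : 𝕜) • e i) = f := by
  set S := CFC.sqrt T with hS
  have hSS : S * S = T := hT.posSemidef.sqrt_mul_sqrt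
  have hSh : S.IsHermitian := sqrt_isHermitian T
  have hSu : IsUnit S.det := by
    have h1 : IsUnit T.det := (Matrix.isUnit_iff_isUnit_det _).1 hT.isUnit
    rw [← hSS, Matrix.det_mul] at h1
    exact isUnit_of_mul_isUnit_left h1
  have hSi : S⁻¹.IsHermitian := hSh.inv
  -- With `S = T^{1/2}`, `T + s M = S (1 + s S⁻¹ M S⁻¹) S`; an eigenbasis of the inner matrix
  -- diagonalises all `s` at once.
  have hN : (S⁻¹ * M * S⁻¹).IsHermitian := by
    have := Matrix.isHermitian_mul_mul_conjTranspose S⁻¹ hM.isHermitian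
    rwa [hSi.eq] at this
  set b := hN.eigenvectorBasis with hb
  set μ := hN.eigenvalues with hμ
  have hNb (i : Fin d) : (S⁻¹ * M * S⁻¹).toEuclideanLin (b i) = ((μ i : ℝ) : 𝕜) • b i := by
    have := hN.mulVec_eigenvectorBasis i
    rw [Matrix.toLpLin_apply, this, RCLike.real_smul_eq_coe_smul (K := 𝕜)]
    rfl
  have hμq (i : Fin d) : μ i = quadForm M (S⁻¹.toEuclideanLin (b i)) := by
    rw [quadForm, ← hSi.inner_toEuclideanLin_left, ← toEuclideanLin_mul_apply,
      ← toEuclideanLin_mul_apply, hNb, inner_smul_left, RCLike.conj_ofReal,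
      RCLike.re_ofReal_mul, inner_self_eq_norm_sq, b.orthonormal.1 i]
    simp
  -- The vectors `S⁻¹ b_i` are normalised for the form of `T`, so the comparison of forms bounds the
  -- eigenvalues by `κ`.
  have hTq (i : Fin d) : quadForm T (S⁻¹.toEuclideanLin (b i)) = 1 := by
    rw [← hT.posSemidef.norm_sqrt_sq, ← hS, ← toEuclideanLin_mul_apply,
      Matrix.mul_nonsing_inv _ hSu, toEuclideanLin_one_apply, b.orthonormal.1 i, one_pow]
  have hμ0 (i : Fin d) : 0 ≤ μ i := by
    rw [hμq]
    exact hM.quadForm_nonneg _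
  refine ⟨fun i => inner 𝕜 (b i) (S⁻¹.toEuclideanLin f) • S⁻¹.toEuclideanLin (b i), μ, hμ0,
    fun i => ?_, fun s hs => ?_⟩
  · have := hMT (S⁻¹.toEuclideanLin (b i))
    rwa [hTq, ← hμq, mul_one] at this
  · have hMS (i : Fin d) : M.toEuclideanLin (S⁻¹.toEuclideanLin (b i)) =
        ((μ i : ℝ) : 𝕜) • S.toEuclideanLin (b i) := by
      rw [← map_smul, ← hNb, ← toEuclideanLin_mul_apply, ← toEuclideanLin_mul_apply, ← mul_assoc,
        ← mul_assoc, Matrix.mul_nonsing_inv _ hSu, one_mul]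
    have hTS (i : Fin d) : T.toEuclideanLin (S⁻¹.toEuclideanLin (b i)) =
        S.toEuclideanLin (b i) := by
      rw [← toEuclideanLin_mul_apply, ← hSS, mul_assoc, Matrix.mul_nonsing_inv _ hSu, mul_one]
    have hterm (i : Fin d) : (T + s • M).toEuclideanLin ((((1 + s * μ i)⁻¹ : ℝ) : 𝕜) •
        inner 𝕜 (b i) (S⁻¹.toEuclideanLin f) • S⁻¹.toEuclideanLin (b i)) =
        S.toEuclideanLin (inner 𝕜 (b i) (S⁻¹.toEuclideanLin f) • b i) := by
      have hne : 1 + s * μ i ≠ 0 := by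
        have := mul_nonneg hs (hμ0 i)
        linarith
      rw [map_smul, map_smul, toEuclideanLin_add_apply, toEuclideanLin_real_smul_apply, hTS, hMS,
        map_smul, smul_comm]
      congr 1
      have : S.toEuclideanLin (b i) + (s : 𝕜) • ((μ i : ℝ) : 𝕜) • S.toEuclideanLin (b i) =
          ((1 + s * μ i : ℝ) : 𝕜) • S.toEuclideanLin (b i) := by
        push_cast
        rw [add_smul, one_smul, mul_smul]
      rw [this, smul_smul, ← RCLike.ofReal_mul, inv_mul_cancel₀ hne, RCLike.ofReal_one, one_smul]
    rw [map_sum, Finset.sum_congr rfl fun i _ => hterm i, ← map_sum, b.sum_repr',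
      ← toEuclideanLin_mul_apply, Matrix.mul_nonsing_inv _ hSu, toEuclideanLin_one_apply]

end QuadForm

theorem ENNReal.tsum_ite_le_of_subsingleton {ι : Type*} {p : ι → Prop} [DecidablePred p]
    (hp : ∀ i j, p i → p j → i = j) (x : ℝ≥0∞) : ∑' i, (if p i then x else 0) ≤ x := by
  by_cases h : ∃ i, p i
  · obtain ⟨i, hi⟩ := h
    rw [tsum_eq_single i]
    · simp [hi]
    · intro j hj
      rw [if_neg]
      exact fun hpj => hj (hp j i hpj hi)
  · push Not at h
    simp [h]

/-! ### Combinatorics of atoms: children, telescoping over generations, sums over sub-atoms. -/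

namespace AtomicFiltration

variable {X : Type*} [MeasurableSpace X] {σ : Measure X} {𝓓 : AtomicFiltration σ}

/-- The atom of rank `n` given by a member of `D n`. -/
def atomOf (𝓓 : AtomicFiltration σ) (n : ℤ) (s : 𝓓.D n) : 𝓓.Atom := ⟨n, s, s.2⟩

/-- Atoms sorted by rank. -/
def atomEquiv (𝓓 : AtomicFiltration σ) : (Σ n : ℤ, 𝓓.D n) ≃ 𝓓.Atom where
  toFun p := 𝓓.atomOf p.1 p.2
  invFun I := ⟨I.rk, I.set, I.mem⟩
  left_inv _ := rfl
  right_inv _ := rfl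

instance (n : ℤ) : Countable (𝓓.D n) := (𝓓.countable n).to_subtype

theorem eq_of_mem_of_mem {n : ℤ} {s t : Set X} (hs : s ∈ 𝓓.D n) (ht : t ∈ 𝓓.D n) {x : X}
    (hxs : x ∈ s) (hxt : x ∈ t) : s = t :=
  (𝓓.disjoint n).elim_set hs ht x hxs hxt

theorem measurableSet_of_mem {n : ℤ} {s : Set X} (hs : s ∈ 𝓓.D n) : MeasurableSet s :=
  𝓓.F.le n _ (𝓓.measurable n s hs)

theorem pairwise_disjoint_coe (n : ℤ) : Pairwise (Function.onFun Disjoint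
    fun s : 𝓓.D n => (s : Set X)) := fun s t hst =>
  𝓓.disjoint n s.2 t.2 fun h => hst (Subtype.ext h)

theorem iUnion_coe (n : ℤ) : ⋃ s : 𝓓.D n, (s : Set X) = Set.univ := by
  obtain ⟨S, hS, h⟩ := 𝓓.eq_sUnion n Set.univ MeasurableSet.univ
  refine Set.eq_univ_of_univ_subset ?_
  rw [h]
  exact Set.sUnion_subset fun s hs => Set.subset_iUnion_of_subset ⟨s, hS hs⟩ subset_rfl

theorem Atom.measurableSet (I : 𝓓.Atom) : MeasurableSet I.set := measurableSet_of_mem I.mem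

theorem Atom.measure_ne_top (I : 𝓓.Atom) : σ I.set ≠ ∞ := (𝓓.finite_measure _ _ I.mem).ne

/-- The children of an atom. -/
abbrev Atom.Children (I : 𝓓.Atom) : Type _ := {s : 𝓓.D (I.rk + 1) // (s : Set X) ⊆ I.set}

/-- A child of an atom, as an atom. -/
def Atom.child (I : 𝓓.Atom) (c : I.Children) : 𝓓.Atom := 𝓓.atomOf (I.rk + 1) c.1

theorem Atom.child_isSub (I : 𝓓.Atom) (c : I.Children) : (I.child c).IsSub I :=
  ⟨c.2, by simp [Atom.child, atomOf]⟩

/-- As the filtration increases, `I` is also measurable in the next generation, hence a union of its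
atoms. -/
theorem Atom.iUnion_child (I : 𝓓.Atom) : ⋃ c : I.Children, (I.child c).set = I.set := by
  obtain ⟨S, hS, h⟩ := 𝓓.eq_sUnion (I.rk + 1) I.set
    (𝓓.F.mono (by omega : I.rk ≤ I.rk + 1) _ (𝓓.measurable _ _ I.mem))
  refine (Set.iUnion_subset fun c => c.2).antisymm ?_
  conv_lhs => rw [h]
  refine Set.sUnion_subset fun s hs => ?_
  have hsub : s ⊆ I.set := by
    rw [h]
    exact Set.subset_sUnion_of_mem hs
  exact Set.subset_iUnion_of_subset (⟨⟨s, hS hs⟩, hsub⟩ : I.Children) subset_rfl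

theorem Atom.pairwise_disjoint_child (I : 𝓓.Atom) : Pairwise (Function.onFun Disjoint
    fun c : I.Children => (I.child c).set) := fun _ _ hst =>
  pairwise_disjoint_coe (I.rk + 1) fun h => hst (Subtype.ext h)

/-- Summation of a one-step inequality over all atoms. -/
theorem tsum_atom_le_of_step {φ γ : 𝓓.Atom → ℝ≥0∞} {G : ℝ≥0∞}
    (h0 : ∀ I, I.set = ∅ → φ I = 0)
    (hstep : ∀ I, φ I + γ I ≤ ∑' c : I.Children, φ (I.child c))
    (hG : ∀ n, ∑' s : 𝓓.D n, φ (𝓓.atomOf n s) ≤ G) : ∑' I, γ I ≤ G := by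
  classical
  set Φ : ℤ → ℝ≥0∞ := fun n => ∑' s : 𝓓.D n, φ (𝓓.atomOf n s) with hΦ
  set Γ : ℤ → ℝ≥0∞ := fun n => ∑' s : 𝓓.D n, γ (𝓓.atomOf n s) with hΓ
  have hone (n : ℤ) : Φ n + Γ n ≤ Φ (n + 1) := by
    calc Φ n + Γ n = ∑' s : 𝓓.D n, (φ (𝓓.atomOf n s) + γ (𝓓.atomOf n s)) := ENNReal.tsum_add.symm
      _ ≤ ∑' s : 𝓓.D n, ∑' c : (𝓓.atomOf n s).Children, φ ((𝓓.atomOf n s).child c) :=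
        ENNReal.tsum_le_tsum fun s => hstep _
      _ = ∑' s : 𝓓.D n, ∑' t : 𝓓.D (n + 1),
          if (t : Set X) ⊆ s then φ (𝓓.atomOf (n + 1) t) else 0 := by
        refine tsum_congr fun s => ?_
        exact tsum_subtype {t : 𝓓.D (n + 1) | (t : Set X) ⊆ s} fun t => φ (𝓓.atomOf (n + 1) t)
      _ = ∑' t : 𝓓.D (n + 1), ∑' s : 𝓓.D n,
          if (t : Set X) ⊆ s then φ (𝓓.atomOf (n + 1) t) else 0 := ENNReal.tsum_comm
      _ ≤ ∑' t : 𝓓.D (n + 1), φ (𝓓.atomOf (n + 1) t) := by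
        refine ENNReal.tsum_le_tsum fun t => ?_
        -- The empty set may be an atom, and is then a child of every atom of the preceding rank;
        -- `h0` keeps it from being counted repeatedly. A nonempty atom has at most one parent, by
        -- disjointness.
        rcases Set.eq_empty_or_nonempty (t : Set X) with ht | ⟨x, hx⟩
        · simp [h0 (𝓓.atomOf (n + 1) t) ht]
        · exact ENNReal.tsum_ite_le_of_subsingleton
            (fun s s' hs hs' => Subtype.ext (eq_of_mem_of_mem s.2 s'.2 (hs hx) (hs' hx))) _
  have hsum (n : ℤ) (m : ℕ) : Φ n + ∑ k ∈ Finset.range m, Γ (n + k) ≤ Φ (n + m) := by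
    induction m with
    | zero => simp
    | succ m ih =>
      rw [Finset.sum_range_succ, ← add_assoc]
      refine (add_le_add_left ih _).trans ?_
      have := hone (n + m)
      rwa [add_assoc] at this
  have htot : ∑' I, γ I = ∑' n, Γ n := by
    rw [← 𝓓.atomEquiv.tsum_eq γ]
    exact ENNReal.tsum_sigma' _
  rw [htot, ENNReal.tsum_eq_iSup_sum]
  refine iSup_le fun T => ?_
  -- A finite set of ranks lies in an interval. Telescoping over it and discarding the nonnegative
  -- initial term `Φ a` avoids any limit at rank `-∞`.
  obtain ⟨a, ha⟩ := T.bddBelow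
  obtain ⟨b, hb⟩ := T.bddAbove
  have hT : T ⊆ (Finset.range (b + 1 - a).toNat).image fun k : ℕ => a + k := by
    intro x hx
    have h1 := ha hx
    have h2 := hb hx
    rw [Finset.mem_image]
    exact ⟨(x - a).toNat, by rw [Finset.mem_range]; omega, by omega⟩
  refine (Finset.sum_le_sum_of_subset hT).trans ?_
  rw [Finset.sum_image (by intro x _ y _ h; simpa using h)]
  exact le_add_self.trans ((hsum a _).trans (hG _))

/-- The sum of `q` over all atoms contained in `I`. -/
noncomputable def subSum (q : 𝓓.Atom → ℝ≥0∞) (I : 𝓓.Atom) : ℝ≥0∞ := ∑' J : {J : 𝓓.Atom // J.IsSub I}, q J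

/-- A nonempty sub-atom of `I` is either `I` itself or contained in at most one child, never both,
as children have larger rank. Only this inequality is needed, so the case of no such child is
harmless. -/
theorem add_tsum_subSum_child_le {q : 𝓓.Atom → ℝ≥0∞} (h0 : ∀ J, J.set = ∅ → q J = 0)
    (I : 𝓓.Atom) : q I + ∑' c : I.Children, subSum q (I.child c) ≤ subSum q I := by
  classical
  have hsub (I : 𝓓.Atom) : subSum q I = ∑' J, if J.IsSub I then q J else 0 :=
    tsum_subtype {J : 𝓓.Atom | J.IsSub I} q
  have hI : q I = ∑' J, if J = I then q J else 0 := (tsum_ite_eq I q).symm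
  simp_rw [hsub]
  rw [ENNReal.tsum_comm, hI, ← ENNReal.tsum_add]
  refine ENNReal.tsum_le_tsum fun J => ?_
  rcases Set.eq_empty_or_nonempty J.set with hJ | ⟨x, hx⟩
  · simp [h0 J hJ]
  by_cases hJI : J = I
  · subst hJI
    have h1 (c : J.Children) : ¬ J.IsSub (J.child c) := by
      intro h
      have := h.2
      simp [Atom.child, atomOf] at this
    have h2 : J.IsSub J := ⟨subset_rfl, le_rfl⟩
    simp [h1, h2]
  · rw [if_neg hJI, zero_add]
    by_cases hJs : J.IsSub I
    · rw [if_pos hJs]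
      exact ENNReal.tsum_ite_le_of_subsingleton (fun c c' hc hc' => Subtype.ext (Subtype.ext
        (eq_of_mem_of_mem c.1.2 c'.1.2 (hc.1 hx) (hc'.1 hx)))) _
    · have h1 (c : I.Children) : ¬ J.IsSub (I.child c) := fun h =>
        hJs ⟨h.1.trans c.2, (I.child_isSub c).2.trans h.2⟩
      simp [h1]

end AtomicFiltration

/-! ### Measurability of square roots and products of matrix functions. -/

section Measurability

variable {X : Type*} [MeasurableSpace X] {σ : Measure X} {𝕜 : Type*} [RCLike 𝕜] {d : ℕ}

theorem isClosed_posSemidef : IsClosed {M : Matrix (Fin d) (Fin d) 𝕜 | M.PosSemidef} := by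
  have h : {M : Matrix (Fin d) (Fin d) 𝕜 | M.PosSemidef} =
      {M | M.conjTranspose = M} ∩ ⋂ v : Fin d → 𝕜, {M | 0 ≤ dotProduct (star v) (M.mulVec v)} := by
    ext M
    simp only [Set.mem_ofPred_eq, Set.mem_inter_iff, Set.mem_iInter]
    exact Matrix.posSemidef_iff_dotProduct_mulVec
  rw [h]
  refine (isClosed_eq (by fun_prop) continuous_id).inter (isClosed_iInter fun v => ?_)
  exact isClosed_Ici.preimage (by fun_prop : Continuous fun M : Matrix (Fin d) (Fin d) 𝕜 =>
    dotProduct (star v) (M.mulVec v))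

/-- Squaring is continuous and injective on the closed set of positive semidefinite matrices, hence
a measurable embedding (Lusin–Souslin). Measurability of `W` therefore passes to its square root. -/
theorem aestronglyMeasurable_sqrt_apply {W : X → Matrix (Fin d) (Fin d) 𝕜}
    (hW : ∀ x, (W x).PosSemidef) (hm : ∀ i j, AEStronglyMeasurable (fun x => W x i j) σ)
    (i j : Fin d) : AEStronglyMeasurable (fun x => CFC.sqrt (W x) i j) σ := by
  let _ : MeasurableSpace (Matrix (Fin d) (Fin d) 𝕜) :=
    inferInstanceAs (MeasurableSpace (Fin d → Fin d → 𝕜))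
  have _ : BorelSpace (Matrix (Fin d) (Fin d) 𝕜) :=
    inferInstanceAs (BorelSpace (Fin d → Fin d → 𝕜))
  have _ : PolishSpace (Matrix (Fin d) (Fin d) 𝕜) :=
    inferInstanceAs (PolishSpace (Fin d → Fin d → 𝕜))
  have hWm : AEMeasurable W σ :=
    aemeasurable_pi_iff.2 fun i => aemeasurable_pi_iff.2 fun j => (hm i j).aemeasurable
  have he := ContinuousOn.measurableEmbedding
    (isClosed_posSemidef (𝕜 := 𝕜) (d := d)).measurableSet
    (f := fun M : Matrix (Fin d) (Fin d) 𝕜 => M * M) (by fun_prop) (by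
      intro M hM N hN h
      exact (CFC.sqrt_unique (a := N * N) (b := M) h
        (Matrix.nonneg_iff_posSemidef.2 hM)).symm.trans (CFC.sqrt_unique (a := N * N) (b := N) rfl
        (Matrix.nonneg_iff_posSemidef.2 hN)))
  have h1 : AEMeasurable (fun x => (⟨CFC.sqrt (W x),
      Matrix.nonneg_iff_posSemidef.1 (CFC.sqrt_nonneg _)⟩ :
        {M : Matrix (Fin d) (Fin d) 𝕜 | M.PosSemidef})) σ := by
    rw [← he.aemeasurable_comp_iff]
    refine hWm.congr (Filter.Eventually.of_forall fun x => ?_)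
    exact (hW x).sqrt_mul_sqrt.symm
  have h2 : AEMeasurable (fun x => CFC.sqrt (W x)) σ := measurable_subtype_coe.comp_aemeasurable h1
  exact (aemeasurable_pi_iff.1 (aemeasurable_pi_iff.1 h2 i) j).aestronglyMeasurable

theorem aestronglyMeasurable_toEuclideanLin {V : X → Matrix (Fin d) (Fin d) 𝕜}
    {f : X → EuclideanSpace 𝕜 (Fin d)} (hV : ∀ i j, AEStronglyMeasurable (fun x => V x i j) σ)
    (hf : AEStronglyMeasurable f σ) :
    AEStronglyMeasurable (fun x => (V x).toEuclideanLin (f x)) σ := by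
  have hfi (j : Fin d) : AEStronglyMeasurable (fun x => f x j) σ :=
    (EuclideanSpace.proj (𝕜 := 𝕜) j).continuous.comp_aestronglyMeasurable hf
  have h : AEMeasurable (fun x => (V x).mulVec (f x).ofLp) σ := by
    refine aemeasurable_pi_iff.2 fun i => ?_
    have : AEStronglyMeasurable (fun x => ∑ j, V x i j * f x j) σ :=
      Finset.aestronglyMeasurable_fun_sum _ fun j _ => (hV i j).mul (hfi j)
    exact this.aemeasurable
  exact (PiLp.continuous_toLp 2 _).comp_aestronglyMeasurable h.aestronglyMeasurable

end Measurability

/-! ### Averages of the weight and of `W^{1/2} g`. -/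

section Averages

open AtomicFiltration

variable {X : Type*} [MeasurableSpace X] {σ : Measure X} {𝓓 : AtomicFiltration σ}
  {𝕜 : Type*} [RCLike 𝕜] {d : ℕ} {W : X → Matrix (Fin d) (Fin d) 𝕜}

theorem real_mul_re_inner_setAverage {E : Type*} [NormedAddCommGroup E] [InnerProductSpace 𝕜 E]
    [CompleteSpace E] [NormedSpace ℝ E] [IsScalarTower ℝ 𝕜 E]
    {f : X → E} {s : Set X} (hf : IntegrableOn f s σ) (hs : σ s ≠ ∞) (v : E) :
    σ.real s * RCLike.re (inner 𝕜 (⨍ x in s, f x ∂σ) v) =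
      ∫ x in s, RCLike.re (inner 𝕜 (f x) v) ∂σ := by
  have h1 : ∫ x in s, RCLike.re (inner 𝕜 (f x) v) ∂σ =
      RCLike.re (inner 𝕜 (∫ x in s, f x ∂σ) v) := by
    rw [inner_re_symm, ← integral_inner hf, ← integral_re]
    · simp only [inner_re_symm v]
    · exact hf.const_inner v
  rw [h1, ← measure_smul_setAverage f hs, RCLike.real_smul_eq_coe_smul (K := 𝕜), inner_smul_left,
    RCLike.conj_ofReal, RCLike.re_ofReal_mul]

/-- The countably many atoms of rank `0` cover the space, and the entries are integrable on each. -/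
theorem IsMatrixWeight.aestronglyMeasurable (hW : IsMatrixWeight 𝓓 W) (i j : Fin d) :
    AEStronglyMeasurable (fun x => W x i j) σ := by
  have h := (aestronglyMeasurable_iUnion_iff (s := fun s : 𝓓.D 0 => (s : Set X)) (μ := σ)
    (f := fun x => W x i j)).2 fun s => (hW.integrableOn (𝓓.atomOf 0 s) i j).aestronglyMeasurable
  rwa [iUnion_coe, Measure.restrict_univ] at h

theorem IsMatrixWeight.aestronglyMeasurable_sqrt (hW : IsMatrixWeight 𝓓 W) (i j : Fin d) :
    AEStronglyMeasurable (fun x => CFC.sqrt (W x) i j) σ :=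
  aestronglyMeasurable_sqrt_apply hW.posSemidef hW.aestronglyMeasurable i j

theorem IsMatrixWeight.integrableOn_toEuclideanLin (hW : IsMatrixWeight 𝓓 W) (I : 𝓓.Atom)
    (v : EuclideanSpace 𝕜 (Fin d)) :
    IntegrableOn (fun x => (W x).toEuclideanLin v) I.set σ := by
  refine Integrable.of_eval_piLp fun i => ?_
  exact integrable_finsetSum Finset.univ fun j _ => (hW.integrableOn I i j).mul_const (v j)

theorem toEuclideanLin_matrixAvg (hW : IsMatrixWeight 𝓓 W) (I : 𝓓.Atom)
    (v : EuclideanSpace 𝕜 (Fin d)) :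
    (matrixAvg σ W I.set).toEuclideanLin v = ⨍ x in I.set, (W x).toEuclideanLin v ∂σ := by
  ext i
  have h := (EuclideanSpace.proj (𝕜 := 𝕜) i).integral_comp_comm (hW.integrableOn_toEuclideanLin I v)
  rw [setAverage_eq]
  have h2 : (∫ x in I.set, (W x).toEuclideanLin v ∂σ) i = ∑ j, (∫ x in I.set, W x i j ∂σ) * v j := by
    refine h.symm.trans ?_
    have h3 (x : X) : EuclideanSpace.proj (𝕜 := 𝕜) i ((W x).toEuclideanLin v) =
      ∑ j, W x i j * v j := rfl
    simp_rw [h3]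
    rw [integral_finsetSum _ fun j _ => (hW.integrableOn I i j).mul_const _]
    exact Finset.sum_congr rfl fun j _ => integral_mul_const _ _
  rw [PiLp.smul_apply, h2, Finset.smul_sum]
  have h4 : ((matrixAvg σ W I.set).toEuclideanLin v) i = ∑ j, matrixAvg σ W I.set i j * v j := rfl
  rw [h4]
  refine Finset.sum_congr rfl fun j _ => ?_
  rw [matrixAvg, Matrix.of_apply, setAverage_eq, smul_mul_assoc]

theorem IsMatrixWeight.integrableOn_quadForm (hW : IsMatrixWeight 𝓓 W) (I : 𝓓.Atom)
    (v : EuclideanSpace 𝕜 (Fin d)) : IntegrableOn (fun x => quadForm (W x) v) I.set σ :=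
  ((hW.integrableOn_toEuclideanLin I v).inner_const v).re

theorem real_mul_quadForm_matrixAvg (hW : IsMatrixWeight 𝓓 W) (I : 𝓓.Atom)
    (v : EuclideanSpace 𝕜 (Fin d)) :
    σ.real I.set * quadForm (matrixAvg σ W I.set) v = ∫ x in I.set, quadForm (W x) v ∂σ := by
  rw [quadForm, toEuclideanLin_matrixAvg hW,
    real_mul_re_inner_setAverage (hW.integrableOn_toEuclideanLin I v) I.measure_ne_top]
  rfl

theorem IsMatrixWeight.posSemidef_matrixAvg (hW : IsMatrixWeight 𝓓 W) (I : 𝓓.Atom) :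
    (matrixAvg σ W I.set).PosSemidef := by
  refine posSemidef_of_quadForm_nonneg ?_ fun v => ?_
  · ext i j
    rw [Matrix.conjTranspose_apply, matrixAvg, Matrix.of_apply, Matrix.of_apply, setAverage_eq,
      setAverage_eq]
    have h (x : X) : W x i j = (starRingEnd 𝕜) (W x j i) :=
      ((hW.posSemidef x).isHermitian.apply i j).symm
    simp_rw [h]
    rw [integral_conj, RCLike.real_smul_eq_coe_mul, RCLike.real_smul_eq_coe_mul]
    simp
  · have h := real_mul_quadForm_matrixAvg hW I v
    have h1 : 0 ≤ ∫ x in I.set, quadForm (W x) v ∂σ :=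
      integral_nonneg fun x => (hW.posSemidef x).quadForm_nonneg v
    rw [← h] at h1
    rcases (measureReal_nonneg (μ := σ) (s := I.set)).eq_or_lt with h0 | h0
    · rw [quadForm, toEuclideanLin_matrixAvg hW, setAverage_eq, ← h0]
      simp
    · exact nonneg_of_mul_nonneg_right h1 h0

theorem IsMatrixWeight.memLp_sqrt_toEuclideanLin (hW : IsMatrixWeight 𝓓 W) (I : 𝓓.Atom)
    (v : EuclideanSpace 𝕜 (Fin d)) :
    MemLp (fun x => (CFC.sqrt (W x)).toEuclideanLin v) 2 (σ.restrict I.set) := by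
  have hm : AEStronglyMeasurable (fun x => (CFC.sqrt (W x)).toEuclideanLin v) σ :=
    aestronglyMeasurable_toEuclideanLin hW.aestronglyMeasurable_sqrt aestronglyMeasurable_const
  rw [memLp_two_iff_integrable_sq_norm hm.restrict]
  simp_rw [fun x => (hW.posSemidef x).norm_sqrt_sq v]
  exact hW.integrableOn_quadForm I v

/-- Expanding `g` in coordinates gives a finite sum of products of two `L²` functions on the atom.
-/
theorem IsMatrixWeight.integrableOn_sqrt_toEuclideanLin (hW : IsMatrixWeight 𝓓 W) (I : 𝓓.Atom)
    {g : X → EuclideanSpace 𝕜 (Fin d)} (hg : MemLp g 2 σ) :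
    IntegrableOn (fun x => (CFC.sqrt (W x)).toEuclideanLin (g x)) I.set σ := by
  have h1 (x : X) : (CFC.sqrt (W x)).toEuclideanLin (g x) =
      ∑ j, g x j • (CFC.sqrt (W x)).toEuclideanLin (EuclideanSpace.single j (1 : 𝕜)) := by
    have := (EuclideanSpace.basisFun (Fin d) 𝕜).sum_repr (g x)
    conv_lhs => rw [← this]
    simp [map_sum]
  simp_rw [h1]
  refine integrable_finsetSum _ fun j _ => ?_
  have h2 : MemLp (fun x => g x j) 2 (σ.restrict I.set) :=
    ((EuclideanSpace.proj (𝕜 := 𝕜) j).comp_memLp' hg).restrict _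
  exact memLp_one_iff_integrable.1 ((hW.memLp_sqrt_toEuclideanLin I _).smul h2)

theorem two_mul_re_inner_sqrt_le {M : Matrix (Fin d) (Fin d) 𝕜} (hM : M.PosSemidef)
    (g v : EuclideanSpace 𝕜 (Fin d)) :
    2 * RCLike.re (inner 𝕜 ((CFC.sqrt M).toEuclideanLin g) v) ≤ ‖g‖ ^ 2 + quadForm M v := by
  rw [(sqrt_isHermitian M).inner_toEuclideanLin_left, ← hM.norm_sqrt_sq]
  have h := norm_sub_sq (𝕜 := 𝕜) g ((CFC.sqrt M).toEuclideanLin v)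
  have := sq_nonneg ‖g - (CFC.sqrt M).toEuclideanLin v‖
  linarith

/-- The integrated form of `0 ≤ ‖g - W^{1/2} v‖²`. It is the dual expression of `⟨⟨W⟩_I⁻¹ f_I, f_I⟩
≤ ⟨‖g‖²⟩_I`, and makes sense for singular `⟨W⟩_I`. -/
theorem real_mul_two_mul_re_inner_le (hW : IsMatrixWeight 𝓓 W) (I : 𝓓.Atom)
    {g : X → EuclideanSpace 𝕜 (Fin d)} (hg : MemLp g 2 σ) (v : EuclideanSpace 𝕜 (Fin d)) :
    σ.real I.set *
        (2 * RCLike.re (inner 𝕜 (⨍ x in I.set, (CFC.sqrt (W x)).toEuclideanLin (g x) ∂σ) v)) ≤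
      ∫ x in I.set, ‖g x‖ ^ 2 ∂σ + σ.real I.set * quadForm (matrixAvg σ W I.set) v := by
  have h1 := hW.integrableOn_sqrt_toEuclideanLin I hg
  have h2 : Integrable (fun x => ‖g x‖ ^ 2) σ := (memLp_two_iff_integrable_sq_norm hg.1).1 hg
  rw [mul_left_comm, real_mul_re_inner_setAverage h1 I.measure_ne_top,
    real_mul_quadForm_matrixAvg hW, ← integral_add h2.integrableOn (hW.integrableOn_quadForm I v),
    ← integral_const_mul]
  exact integral_mono ((h1.inner_const v).re.const_mul 2)
    (h2.integrableOn.add (hW.integrableOn_quadForm I v))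
    fun x => two_mul_re_inner_sqrt_le (hW.posSemidef x) (g x) v

end Averages

/-! ### The weighted and unweighted embeddings are equivalent. -/

section Equivalence

open AtomicFiltration Filter Topology

variable {X : Type*} [MeasurableSpace X] {σ : Measure X} {𝓓 : AtomicFiltration σ}
  {𝕜 : Type*} [RCLike 𝕜] {d : ℕ} {W : X → Matrix (Fin d) (Fin d) 𝕜}
  {A : 𝓓.Atom → Matrix (Fin d) (Fin d) 𝕜}

theorem eLpNorm_two_sq_eq_lintegral {E : Type*} [NormedAddCommGroup E] (f : X → E) :
    eLpNorm f 2 σ ^ 2 = ∫⁻ x, ENNReal.ofReal (‖f x‖ ^ 2) ∂σ := by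
  have h := eLpNorm_nnreal_pow_eq_lintegral (p := 2) (f := f) (μ := σ) two_ne_zero
  simp only [NNReal.coe_ofNat, ENNReal.coe_ofNat, ENNReal.rpow_ofNat] at h
  rw [h]
  refine lintegral_congr fun x => ?_
  rw [ENNReal.ofReal_pow (norm_nonneg _), ofReal_norm]

theorem weightedNormSq_eq (hW : ∀ x, (W x).PosSemidef) (f : X → EuclideanSpace 𝕜 (Fin d)) :
    weightedNormSq σ W f =
      eLpNorm (fun x => (CFC.sqrt (W x)).toEuclideanLin (f x)) 2 σ ^ 2 := by
  rw [eLpNorm_two_sq_eq_lintegral]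
  exact lintegral_congr fun x => by rw [(hW x).norm_sqrt_sq, quadForm]

theorem UnweightedEmbedding.weightedEmbedding {a : ℝ≥0} (hW : IsMatrixWeight 𝓓 W)
    (h : UnweightedEmbedding 𝓓 W A a) : WeightedEmbedding 𝓓 W A a := by
  intro f hf
  have hg : MemLp (fun x => (CFC.sqrt (W x)).toEuclideanLin (f x)) 2 σ := by
    refine ⟨aestronglyMeasurable_toEuclideanLin hW.aestronglyMeasurable_sqrt hf.1, ?_⟩
    have := hf.2
    rw [weightedNormSq_eq hW.posSemidef] at this
    exact (ENNReal.pow_lt_top_iff.1 this).resolve_right two_ne_zero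
  have h1 := h _ hg
  rw [← weightedNormSq_eq hW.posSemidef] at h1
  convert h1 using 1
  unfold embeddingSum
  simp_rw [← toEuclideanLin_mul_apply, (hW.posSemidef _).sqrt_mul_sqrt]

theorem aestronglyMeasurable_inv_apply {V : X → Matrix (Fin d) (Fin d) 𝕜}
    (hV : ∀ i j, AEStronglyMeasurable (fun x => V x i j) σ) (i j : Fin d) :
    AEStronglyMeasurable (fun x => (V x)⁻¹ i j) σ := by
  have hVm : AEStronglyMeasurable V σ :=
    AEMeasurable.aestronglyMeasurable (β := Fin d → Fin d → 𝕜)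
      (aemeasurable_pi_iff.2 fun i => aemeasurable_pi_iff.2 fun j => (hV i j).aemeasurable)
  have h1 : AEStronglyMeasurable (fun x => (V x).det) σ :=
    (by fun_prop : Continuous fun M : Matrix (Fin d) (Fin d) 𝕜 => M.det).comp_aestronglyMeasurable
      hVm
  have h2 : AEStronglyMeasurable (fun x => (V x).adjugate i j) σ :=
    (by fun_prop : Continuous fun M : Matrix (Fin d) (Fin d) 𝕜 =>
      M.adjugate i j).comp_aestronglyMeasurable hVm
  have h3 (x : X) : (V x)⁻¹ i j = (V x).det⁻¹ * (V x).adjugate i j := by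
    rw [Matrix.inv_def, Matrix.smul_apply, Ring.inverse_eq_inv', smul_eq_mul]
  simp_rw [h3]
  exact h1.aemeasurable.inv.aestronglyMeasurable.mul h2

theorem posDef_add_smul_one {V : Matrix (Fin d) (Fin d) 𝕜} (hV : V.PosSemidef) {ε : ℝ}
    (hε : 0 < ε) : (V + ε • (1 : Matrix (Fin d) (Fin d) 𝕜)).PosDef := by
  refine Matrix.PosDef.posSemidef_add hV ?_
  exact Matrix.PosDef.one.smul hε

theorem toEuclideanLin_inv_apply {T : Matrix (Fin d) (Fin d) 𝕜} (hT : T.PosDef)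
    (f : EuclideanSpace 𝕜 (Fin d)) : T.toEuclideanLin (T⁻¹.toEuclideanLin f) = f := by
  rw [← toEuclideanLin_mul_apply, Matrix.mul_nonsing_inv _
    ((Matrix.isUnit_iff_isUnit_det _).1 hT.isUnit), toEuclideanLin_one_apply]

/-- Lower semicontinuity of the embedding sum in the averages. -/
theorem embeddingSum_le_of_tendsto {V V' : X → Matrix (Fin d) (Fin d) 𝕜}
    {f : ℕ → X → EuclideanSpace 𝕜 (Fin d)} {g : X → EuclideanSpace 𝕜 (Fin d)} {C : ℝ≥0∞}
    (h : ∀ I : 𝓓.Atom, Tendsto (fun n => ⨍ x in I.set, (V x).toEuclideanLin (f n x) ∂σ) atTop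
      (𝓝 (⨍ x in I.set, (V' x).toEuclideanLin (g x) ∂σ)))
    (hC : ∀ n, embeddingSum 𝓓 V A (f n) ≤ C) : embeddingSum 𝓓 V' A g ≤ C := by
  rw [embeddingSum, ENNReal.tsum_eq_iSup_sum]
  refine iSup_le fun T => ?_
  refine le_of_tendsto (x := atTop) (tendsto_finsetSum T fun I _ => ?_)
    (Eventually.of_forall fun n => (ENNReal.sum_le_tsum T).trans (hC n))
  refine ENNReal.Tendsto.mul_const ?_ (Or.inr I.measure_ne_top)
  refine ((ENNReal.continuous_pow 2).tendsto _).comp ?_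
  refine (continuous_enorm.tendsto _).comp ?_
  exact ((LinearMap.continuous_of_finiteDimensional _).tendsto _).comp (h I)

theorem WeightedEmbedding.unweightedEmbedding {a : ℝ≥0} (hW : IsMatrixWeight 𝓓 W)
    (h : WeightedEmbedding 𝓓 W A a) : UnweightedEmbedding 𝓓 W A a := by
  intro g hg
  set ε : ℕ → ℝ := fun n => 1 / ((n : ℝ) + 1) with hε
  have hε0 (n : ℕ) : 0 < ε n := by positivity
  have hε1 (n : ℕ) : ε n ≤ 1 := by
    rw [hε, div_le_one (by positivity)]
    have := Nat.cast_nonneg (α := ℝ) n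
    linarith
  have hεt : Tendsto ε atTop (𝓝 0) := tendsto_one_div_add_atTop_nhds_zero_nat
  set u : X → EuclideanSpace 𝕜 (Fin d) := fun x => (CFC.sqrt (W x)).toEuclideanLin (g x) with hu
  have hum : AEStronglyMeasurable u σ :=
    aestronglyMeasurable_toEuclideanLin hW.aestronglyMeasurable_sqrt hg.1
  -- A substitute for `W^{-1/2} g` where `W` may be singular. Its `L²(W)` norm is at most the norm
  -- of `g`, and `W f_n` differs from `W^{1/2} g` by at most `√ε_n ‖g‖` pointwise.
  set f : ℕ → X → EuclideanSpace 𝕜 (Fin d) := fun n x =>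
    (W x + ε n • (1 : Matrix (Fin d) (Fin d) 𝕜))⁻¹.toEuclideanLin (u x) with hf
  have hsol (n : ℕ) (x : X) :
      (W x + ε n • (1 : Matrix (Fin d) (Fin d) 𝕜)).toEuclideanLin (f n x) = u x :=
    toEuclideanLin_inv_apply (posDef_add_smul_one (hW.posSemidef x) (hε0 n)) _
  have hfm (n : ℕ) : AEStronglyMeasurable (f n) σ := by
    refine aestronglyMeasurable_toEuclideanLin (aestronglyMeasurable_inv_apply fun i j => ?_) hum
    exact (hW.aestronglyMeasurable i j).add aestronglyMeasurable_const
  have hdual (x : X) (v : EuclideanSpace 𝕜 (Fin d)) :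
      2 * RCLike.re (inner 𝕜 (u x) v) ≤ ‖g x‖ ^ 2 + quadForm (W x) v :=
    two_mul_re_inner_sqrt_le (hW.posSemidef x) (g x) v
  have hnorm (n : ℕ) : weightedNormSq σ W (f n) ≤ eLpNorm g 2 σ ^ 2 := by
    rw [eLpNorm_two_sq_eq_lintegral]
    exact lintegral_mono fun x => ENNReal.ofReal_le_ofReal
      (quadForm_le_of_regularized (hε0 n).le (hdual x) (hsol n x))
  have hg2 : eLpNorm g 2 σ ^ 2 < ∞ := ENNReal.pow_lt_top hg.2
  have hdist (n : ℕ) (x : X) : ‖u x - (W x).toEuclideanLin (f n x)‖ ^ 2 ≤ ε n * ‖g x‖ ^ 2 :=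
    norm_sub_sq_le_of_regularized (hε0 n).le (hdual x) (hsol n x)
  refine embeddingSum_le_of_tendsto (f := f) (V := W) (fun I => ?_) fun n =>
    (h (f n) ⟨hfm n, (hnorm n).trans_lt hg2⟩).trans (by gcongr; exact hnorm n)
  have _ : IsFiniteMeasure (σ.restrict I.set) :=
    isFiniteMeasure_restrict.2 I.measure_ne_top
  simp_rw [setAverage_eq]
  refine Tendsto.const_smul ?_ _
  -- Since `ε_n ≤ 1`, `‖W f_n‖ ≤ ‖u‖ + ‖g‖`, which is integrable on an atom of finite measure.
  refine tendsto_integral_of_dominated_convergence (fun x => ‖u x‖ + ‖g x‖)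
    (fun n => (aestronglyMeasurable_toEuclideanLin hW.aestronglyMeasurable (hfm n)).restrict)
    ((hW.integrableOn_sqrt_toEuclideanLin I hg).norm.add
      ((hg.restrict I.set).integrable one_le_two).norm) (fun n => ae_of_all _ fun x => ?_)
    (ae_of_all _ fun x => ?_)
  · have h1 : ‖u x - (W x).toEuclideanLin (f n x)‖ ≤ ‖g x‖ := by
      refine (sq_le_sq₀ (norm_nonneg _) (norm_nonneg _)).1 ((hdist n x).trans ?_)
      exact mul_le_of_le_one_left (by positivity) (hε1 n)
    calc ‖(W x).toEuclideanLin (f n x)‖ = ‖u x - (u x - (W x).toEuclideanLin (f n x))‖ := by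
          rw [sub_sub_cancel]
      _ ≤ ‖u x‖ + ‖u x - (W x).toEuclideanLin (f n x)‖ := norm_sub_le _ _
      _ ≤ _ := by gcongr
  · rw [tendsto_iff_norm_sub_tendsto_zero]
    have h1 : Tendsto (fun n => √(ε n * ‖g x‖ ^ 2)) atTop (𝓝 0) := by
      have := (hεt.mul_const (‖g x‖ ^ 2)).sqrt
      simpa using this
    refine squeeze_zero (fun n => norm_nonneg _) (fun n => ?_) h1
    rw [norm_sub_rev]
    exact Real.le_sqrt_of_sq_le (hdist n x)

end Equivalence

/-! ### The Carleson condition through scalar quadratic forms, and its necessity. -/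

section Carleson

open AtomicFiltration Filter Topology

variable {X : Type*} [MeasurableSpace X] {σ : Measure X} {𝓓 : AtomicFiltration σ}
  {𝕜 : Type*} [RCLike 𝕜] {d : ℕ} {W : X → Matrix (Fin d) (Fin d) 𝕜}
  {A : 𝓓.Atom → Matrix (Fin d) (Fin d) 𝕜}

/-- The quadratic form at a fixed vector, as a real linear functional of the matrix. -/
def quadFormLin (v : EuclideanSpace 𝕜 (Fin d)) : Matrix (Fin d) (Fin d) 𝕜 →ₗ[ℝ] ℝ where
  toFun M := quadForm M v
  map_add' M N := quadForm_add M N v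
  map_smul' r M := quadForm_smul r M v

theorem hasSum_quadForm {ι : Type*} {N : ι → Matrix (Fin d) (Fin d) 𝕜} (hN : Summable N)
    (v : EuclideanSpace 𝕜 (Fin d)) :
    HasSum (fun i => quadForm (N i) v) (quadForm (∑' i, N i) v) :=
  hN.hasSum.map (quadFormLin v) (LinearMap.continuous_of_finiteDimensional _)

theorem posSemidef_tsum {ι : Type*} {N : ι → Matrix (Fin d) (Fin d) 𝕜} (hN : Summable N)
    (hp : ∀ i, (N i).PosSemidef) : (∑' i, N i).PosSemidef :=
  isClosed_posSemidef.mem_of_tendsto hN.hasSum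
    (Eventually.of_forall fun _ => Matrix.posSemidef_sum _ fun i _ => hp i)

theorem ofReal_quadForm_tsum {ι : Type*} {N : ι → Matrix (Fin d) (Fin d) 𝕜} (hN : Summable N)
    (hp : ∀ i, (N i).PosSemidef) (v : EuclideanSpace 𝕜 (Fin d)) :
    ENNReal.ofReal (quadForm (∑' i, N i) v) = ∑' i, ENNReal.ofReal (quadForm (N i) v) := by
  have h := hasSum_quadForm hN v
  rw [← h.tsum_eq, ENNReal.ofReal_tsum_of_nonneg (fun J => (hp J).quadForm_nonneg v) h.summable]

/-- Cauchy–Schwarz for the form of `N`. It reduces convergence of a series of positive matrices to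
convergence of its quadratic forms. -/
theorem Matrix.PosSemidef.norm_apply_le {N : Matrix (Fin d) (Fin d) 𝕜} (hN : N.PosSemidef)
    (i j : Fin d) : ‖N i j‖ ≤ quadForm N (EuclideanSpace.single i 1) +
      quadForm N (EuclideanSpace.single j 1) := by
  have h1 : N i j = inner 𝕜 ((CFC.sqrt N).toEuclideanLin (EuclideanSpace.single i 1))
      ((CFC.sqrt N).toEuclideanLin (EuclideanSpace.single j 1)) := by
    rw [(sqrt_isHermitian N).inner_toEuclideanLin_left, ← toEuclideanLin_mul_apply,
      hN.sqrt_mul_sqrt, EuclideanSpace.inner_single_left]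
    simp [Matrix.toLpLin_apply]
  rw [h1, ← hN.norm_sqrt_sq, ← hN.norm_sqrt_sq]
  refine (norm_inner_le_norm _ _).trans ?_
  nlinarith [sq_nonneg (‖(CFC.sqrt N).toEuclideanLin (EuclideanSpace.single i (1 : 𝕜))‖ -
    ‖(CFC.sqrt N).toEuclideanLin (EuclideanSpace.single j (1 : 𝕜))‖),
    sq_nonneg ‖(CFC.sqrt N).toEuclideanLin (EuclideanSpace.single i (1 : 𝕜))‖,
    sq_nonneg ‖(CFC.sqrt N).toEuclideanLin (EuclideanSpace.single j (1 : 𝕜))‖]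

theorem summable_of_summable_quadForm {ι : Type*} {N : ι → Matrix (Fin d) (Fin d) 𝕜}
    (hp : ∀ i, (N i).PosSemidef) (h : ∀ v, Summable fun i => quadForm (N i) v) : Summable N :=
  Pi.summable.2 fun i => Pi.summable.2 fun j =>
    Summable.of_norm_bounded ((h _).add (h _)) fun k => (hp k).norm_apply_le i j

theorem Matrix.PosSemidef.real_smul {N : Matrix (Fin d) (Fin d) 𝕜} (hN : N.PosSemidef) {r : ℝ}
    (hr : 0 ≤ r) : (r • N).PosSemidef :=
  hN.smul hr

theorem enorm_sq_mul_measure {E : Type*} [NormedAddCommGroup E] (x : E) {s : Set X}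
    (hs : σ s ≠ ∞) : ‖x‖ₑ ^ 2 * σ s = ENNReal.ofReal (σ.real s * ‖x‖ ^ 2) := by
  rw [ENNReal.ofReal_mul measureReal_nonneg, ofReal_measureReal hs,
    ENNReal.ofReal_pow (norm_nonneg _), ofReal_norm, mul_comm]

/-- The term `|J| ‖A_J^{1/2} ⟨W⟩_J v‖²` of the Carleson sum. -/
noncomputable def carlesonTerm (W : X → Matrix (Fin d) (Fin d) 𝕜) (A : 𝓓.Atom → Matrix (Fin d) (Fin d) 𝕜)
    (v : EuclideanSpace 𝕜 (Fin d)) (J : 𝓓.Atom) : ℝ≥0∞ :=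
  ENNReal.ofReal (σ.real J.set *
    ‖(CFC.sqrt (A J)).toEuclideanLin ((matrixAvg σ W J.set).toEuclideanLin v)‖ ^ 2)

theorem carlesonTerm_eq (hW : IsMatrixWeight 𝓓 W) (hA : ∀ I, (A I).PosSemidef)
    (v : EuclideanSpace 𝕜 (Fin d)) (J : 𝓓.Atom) :
    carlesonTerm W A v J = ENNReal.ofReal (quadForm
      (σ.real J.set • (matrixAvg σ W J.set * A J * matrixAvg σ W J.set)) v) := by
  rw [carlesonTerm, quadForm_smul, quadForm_conj (hW.posSemidef_matrixAvg J).isHermitian (hA J)]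

theorem posSemidef_carleson (hW : IsMatrixWeight 𝓓 W) (hA : ∀ I, (A I).PosSemidef) (J : 𝓓.Atom) :
    (σ.real J.set • (matrixAvg σ W J.set * A J * matrixAvg σ W J.set)).PosSemidef := by
  refine Matrix.PosSemidef.real_smul ?_ measureReal_nonneg
  have := (hA J).mul_mul_conjTranspose_same (matrixAvg σ W J.set)
  rwa [(hW.posSemidef_matrixAvg J).isHermitian.eq] at this

theorem subSum_carlesonTerm_eq (hW : IsMatrixWeight 𝓓 W) (hA : ∀ I, (A I).PosSemidef)
    {I₀ : 𝓓.Atom} (hs : Summable (fun I : {I : 𝓓.Atom // I.IsSub I₀} =>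
      σ.real I.1.set • (matrixAvg σ W I.1.set * A I.1 * matrixAvg σ W I.1.set)))
    (v : EuclideanSpace 𝕜 (Fin d)) :
    subSum (carlesonTerm W A v) I₀ = ENNReal.ofReal (quadForm
      (∑' I : {I : 𝓓.Atom // I.IsSub I₀},
        σ.real I.1.set • (matrixAvg σ W I.1.set * A I.1 * matrixAvg σ W I.1.set)) v) := by
  rw [ofReal_quadForm_tsum hs fun J => posSemidef_carleson hW hA J.1, subSum]
  simp_rw [carlesonTerm_eq hW hA v]

theorem subSum_carlesonTerm_eq_zero (W : X → Matrix (Fin d) (Fin d) 𝕜)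
    (A : 𝓓.Atom → Matrix (Fin d) (Fin d) 𝕜) {I₀ : 𝓓.Atom} (h0 : σ.real I₀.set = 0)
    (v : EuclideanSpace 𝕜 (Fin d)) : subSum (carlesonTerm W A v) I₀ = 0 := by
  rw [subSum, ENNReal.tsum_eq_zero]
  intro J
  have : σ.real J.1.set = 0 := by
    refine le_antisymm ?_ measureReal_nonneg
    rw [← h0]
    exact measureReal_mono J.2.1 I₀.measure_ne_top
  rw [carlesonTerm, this, zero_mul, ENNReal.ofReal_zero]

/-- Tested on vectors with values in `[0, ∞]`, the condition needs no separate summability clause: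
finiteness of the right side forces convergence. It also becomes linear in `b`. -/
theorem matrixCarleson_iff (hW : IsMatrixWeight 𝓓 W) (hA : ∀ I, (A I).PosSemidef) (b : ℝ≥0) :
    MatrixCarleson 𝓓 W A b ↔ ∀ (I₀ : 𝓓.Atom) (v : EuclideanSpace 𝕜 (Fin d)),
      subSum (carlesonTerm W A v) I₀ ≤
        b * ENNReal.ofReal (σ.real I₀.set * quadForm (matrixAvg σ W I₀.set) v) := by
  refine forall_congr' fun I₀ => ?_
  set N : {I : 𝓓.Atom // I.IsSub I₀} → Matrix (Fin d) (Fin d) 𝕜 := fun I =>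
    σ.real I.1.set • (matrixAvg σ W I.1.set * A I.1 * matrixAvg σ W I.1.set) with hN
  have hNp (J) : (N J).PosSemidef := posSemidef_carleson hW hA J.1
  have hV := hW.posSemidef_matrixAvg I₀
  have hb (v : EuclideanSpace 𝕜 (Fin d)) :
      (b : ℝ≥0∞) * ENNReal.ofReal (σ.real I₀.set * quadForm (matrixAvg σ W I₀.set) v) =
        ENNReal.ofReal (σ.real I₀.set * (b * quadForm (matrixAvg σ W I₀.set) v)) := by
    rw [mul_left_comm, ENNReal.ofReal_mul b.coe_nonneg, ENNReal.ofReal_coe_nnreal]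
  have hVb (v : EuclideanSpace 𝕜 (Fin d)) :
      0 ≤ σ.real I₀.set * (b * quadForm (matrixAvg σ W I₀.set) v) :=
    mul_nonneg measureReal_nonneg (mul_nonneg b.coe_nonneg (hV.quadForm_nonneg v))
  have hsub (hs : Summable N) : (σ.real I₀.set)⁻¹ • (∑' I, N I) ≤
      (b : ℝ) • matrixAvg σ W I₀.set ↔ ∀ v, subSum (carlesonTerm W A v) I₀ ≤
        b * ENNReal.ofReal (σ.real I₀.set * quadForm (matrixAvg σ W I₀.set) v) := by
    rw [le_iff_quadForm_le
      ((posSemidef_tsum hs hNp).real_smul (inv_nonneg.2 measureReal_nonneg)).isHermitian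
      (hV.real_smul b.coe_nonneg).isHermitian]
    refine forall_congr' fun v => ?_
    -- On a null `I₀` the factor `|I₀|⁻¹` is `0` and every sub-atom is null, so both inequalities
    -- hold trivially.
    rcases (measureReal_nonneg (μ := σ) (s := I₀.set)).eq_or_lt with h0 | h0
    · rw [subSum_carlesonTerm_eq_zero W A h0.symm, ← h0, quadForm_smul, quadForm_smul, inv_zero,
        zero_mul]
      simpa using mul_nonneg b.coe_nonneg (hV.quadForm_nonneg v)
    · rw [subSum_carlesonTerm_eq hW hA hs, hb, ENNReal.ofReal_le_ofReal_iff (hVb v),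
        quadForm_smul, quadForm_smul, inv_mul_le_iff₀ h0]
  constructor
  · rintro ⟨hs, hle⟩
    exact (hsub hs).1 hle
  · intro h
    have hs : Summable N := by
      refine summable_of_summable_quadForm hNp fun v => ?_
      have h1 : ∑' J, ENNReal.ofReal (quadForm (N J) v) ≠ ∞ := by
        have h2 : ∑' J, ENNReal.ofReal (quadForm (N J) v) = subSum (carlesonTerm W A v) I₀ :=
          tsum_congr fun J => (carlesonTerm_eq hW hA v J.1).symm
        rw [h2]
        refine ((h v).trans_lt ?_).ne
        exact ENNReal.mul_lt_top ENNReal.coe_lt_top ENNReal.ofReal_lt_top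
      have h3 := ENNReal.summable_toReal h1
      refine h3.congr fun J => ?_
      rw [ENNReal.toReal_ofReal ((hNp J).quadForm_nonneg v)]
    exact ⟨hs, (hsub hs).2 h⟩

/-- The matrix sums of the Carleson condition, as a family of positive semidefinite matrices. -/
theorem MatrixCarleson.exists_sum (hW : IsMatrixWeight 𝓓 W) (hA : ∀ I, (A I).PosSemidef)
    {b : ℝ≥0} (h : MatrixCarleson 𝓓 W A b) :
    ∃ S : 𝓓.Atom → Matrix (Fin d) (Fin d) 𝕜, (∀ I, (S I).PosSemidef) ∧
      (∀ I v, subSum (carlesonTerm W A v) I = ENNReal.ofReal (quadForm (S I) v)) ∧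
      ∀ I v, quadForm (S I) v ≤ b * (σ.real I.set * quadForm (matrixAvg σ W I.set) v) := by
  have h' := (matrixCarleson_iff hW hA b).1 h
  refine ⟨_, fun I => posSemidef_tsum (h I).1 fun J => posSemidef_carleson hW hA J.1,
    fun I v => subSum_carlesonTerm_eq hW hA (h I).1 v, fun I v => ?_⟩
  have h1 := h' I v
  have h2 : 0 ≤ σ.real I.set * quadForm (matrixAvg σ W I.set) v :=
    mul_nonneg measureReal_nonneg ((hW.posSemidef_matrixAvg I).quadForm_nonneg v)
  rwa [subSum_carlesonTerm_eq hW hA (h I).1 v, ← ENNReal.ofReal_coe_nnreal,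
    ← ENNReal.ofReal_mul b.coe_nonneg, ENNReal.ofReal_le_ofReal_iff (mul_nonneg b.coe_nonneg h2)] at h1

/-- Testing the embedding on `1_{I₀} W^{1/2} v`. -/
theorem UnweightedEmbedding.matrixCarleson (hW : IsMatrixWeight 𝓓 W)
    (hA : ∀ I, (A I).PosSemidef) {a : ℝ≥0} (h : UnweightedEmbedding 𝓓 W A a) :
    MatrixCarleson 𝓓 W A a := by
  rw [matrixCarleson_iff hW hA]
  intro I₀ v
  set r : X → EuclideanSpace 𝕜 (Fin d) := fun x => (CFC.sqrt (W x)).toEuclideanLin v with hr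
  have hg : MemLp (I₀.set.indicator r) 2 σ :=
    (memLp_indicator_iff_restrict I₀.measurableSet).2 (hW.memLp_sqrt_toEuclideanLin I₀ v)
  have h1 := h _ hg
  have h2 : eLpNorm (I₀.set.indicator r) 2 σ ^ 2 =
      ENNReal.ofReal (σ.real I₀.set * quadForm (matrixAvg σ W I₀.set) v) := by
    rw [eLpNorm_indicator_eq_eLpNorm_restrict I₀.measurableSet, eLpNorm_two_sq_eq_lintegral,
      real_mul_quadForm_matrixAvg hW, ofReal_integral_eq_lintegral_ofReal
        (hW.integrableOn_quadForm I₀ v) (ae_of_all _ fun x => (hW.posSemidef x).quadForm_nonneg v)]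
    exact lintegral_congr fun x => by rw [hr, (hW.posSemidef x).norm_sqrt_sq]
  rw [h2] at h1
  refine le_trans ?_ h1
  -- Atoms not below `I₀` are dropped; on `J ⊂ I₀` the tested function averages to `⟨W⟩_J v`.
  refine le_trans (le_of_eq ?_) (ENNReal.tsum_comp_le_tsum_of_injective
    (Subtype.val_injective (p := fun J : 𝓓.Atom => J.IsSub I₀)) _)
  refine tsum_congr fun J => ?_
  rw [carlesonTerm, ← enorm_sq_mul_measure _ J.1.measure_ne_top, toEuclideanLin_matrixAvg hW]
  congr 4
  rw [setAverage_eq, setAverage_eq]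
  congr 1
  refine setIntegral_congr_fun J.1.measurableSet fun x hx => ?_
  rw [Set.indicator_of_mem (J.2.1 hx), hr, ← toEuclideanLin_mul_apply,
    (hW.posSemidef x).sqrt_mul_sqrt]

end Carleson

/-! ### The Bellman function argument and the passage from Carleson to embedding. -/

section CarlesonEmbedding

open AtomicFiltration Filter Topology

variable {X : Type*} [MeasurableSpace X] {σ : Measure X} {𝓓 : AtomicFiltration σ}
  {𝕜 : Type*} [RCLike 𝕜] {d : ℕ} {W : X → Matrix (Fin d) (Fin d) 𝕜}
  {A : 𝓓.Atom → Matrix (Fin d) (Fin d) 𝕜}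

theorem hasSum_setIntegral_child (I : 𝓓.Atom) {h : X → ℝ} (hh : IntegrableOn h I.set σ) :
    HasSum (fun c : I.Children => ∫ x in (I.child c).set, h x ∂σ) (∫ x in I.set, h x ∂σ) := by
  have h1 := hasSum_integral_iUnion (fun c : I.Children => (I.child c).measurableSet)
    I.pairwise_disjoint_child (f := h) (μ := σ) (by rwa [I.iUnion_child])
  rwa [I.iUnion_child] at h1

/-- The Bellman function `|I| ⟨(⟨W⟩_I + ε + t |I|⁻¹ S_I)⁻¹ f_I, f_I⟩`, with `z_I` the solution of
the linear system, increases from an atom to its children by at least the Carleson term. -/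
theorem bellman_step (hW : IsMatrixWeight 𝓓 W)
    {S : 𝓓.Atom → Matrix (Fin d) (Fin d) 𝕜} (hSp : ∀ I, (S I).PosSemidef)
    (hS : ∀ I v, subSum (carlesonTerm W A v) I = ENNReal.ofReal (quadForm (S I) v))
    {g : X → EuclideanSpace 𝕜 (Fin d)} (hg : MemLp g 2 σ)
    {f : 𝓓.Atom → EuclideanSpace 𝕜 (Fin d)}
    (hf : ∀ I, f I = ⨍ x in I.set, (CFC.sqrt (W x)).toEuclideanLin (g x) ∂σ)
    {ε t : ℝ} (ht : 0 ≤ t) {T : 𝓓.Atom → Matrix (Fin d) (Fin d) 𝕜}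
    {z : 𝓓.Atom → EuclideanSpace 𝕜 (Fin d)} (hTp : ∀ I, (T I).PosSemidef)
    (hT : ∀ I v, σ.real I.set * quadForm (T I) v =
      σ.real I.set * quadForm (matrixAvg σ W I.set) v + σ.real I.set * (ε * ‖v‖ ^ 2) +
        t * quadForm (S I) v)
    (hz : ∀ I, (T I).toEuclideanLin (z I) = f I)
    (hφ : ∀ I, σ.real I.set * RCLike.re (inner 𝕜 (f I) (z I)) ≤ ∫ x in I.set, ‖g x‖ ^ 2 ∂σ)
    (I : 𝓓.Atom) :
    ENNReal.ofReal (σ.real I.set * RCLike.re (inner 𝕜 (f I) (z I))) +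
      ENNReal.ofReal (t * (σ.real I.set * ‖(CFC.sqrt (A I)).toEuclideanLin
        ((matrixAvg σ W I.set).toEuclideanLin (z I))‖ ^ 2)) ≤
      ∑' c : I.Children, ENNReal.ofReal (σ.real (I.child c).set *
        RCLike.re (inner 𝕜 (f (I.child c)) (z (I.child c)))) := by
  have hzq (J : 𝓓.Atom) : RCLike.re (inner 𝕜 (f J) (z J)) = quadForm (T J) (z J) := by
    rw [← hz, quadForm]
  have hφ0 (J : 𝓓.Atom) : 0 ≤ σ.real J.set * RCLike.re (inner 𝕜 (f J) (z J)) := by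
    rw [hzq]
    exact mul_nonneg measureReal_nonneg ((hTp J).quadForm_nonneg _)
  have hg2 : Integrable (fun x => ‖g x‖ ^ 2) σ := (memLp_two_iff_integrable_sq_norm hg.1).1 hg
  have hφs : Summable fun c : I.Children =>
      σ.real (I.child c).set * RCLike.re (inner 𝕜 (f (I.child c)) (z (I.child c))) :=
    Summable.of_nonneg_of_le (fun c => hφ0 _) (fun c => hφ _)
      (hasSum_setIntegral_child I hg2.integrableOn).summable
  -- The parent's solution serves as the test vector in every child. This replaces any convexity or
  -- derivative computation for the matrix inverse.
  set v := z I with hv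
  have hterm0 : 0 ≤ σ.real I.set * ‖(CFC.sqrt (A I)).toEuclideanLin
      ((matrixAvg σ W I.set).toEuclideanLin v)‖ ^ 2 :=
    mul_nonneg measureReal_nonneg (by positivity)
  have hq0 (J : 𝓓.Atom) (hJ : J.set = ∅) : carlesonTerm W A v J = 0 := by
    simp [carlesonTerm, hJ]
  have hSle := add_tsum_subSum_child_le hq0 I
  simp_rw [hS] at hSle
  have hSs : Summable fun c : I.Children => quadForm (S (I.child c)) v := by
    have h1 : ∑' c : I.Children, ENNReal.ofReal (quadForm (S (I.child c)) v) ≠ ∞ :=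
      ((le_add_self.trans hSle).trans_lt ENNReal.ofReal_lt_top).ne
    exact (ENNReal.summable_toReal h1).congr fun c =>
      ENNReal.toReal_ofReal ((hSp _).quadForm_nonneg v)
  have hSle' : σ.real I.set * ‖(CFC.sqrt (A I)).toEuclideanLin
      ((matrixAvg σ W I.set).toEuclideanLin v)‖ ^ 2 +
        ∑' c : I.Children, quadForm (S (I.child c)) v ≤ quadForm (S I) v := by
    rw [carlesonTerm, ← ENNReal.ofReal_tsum_of_nonneg
      (fun c => (hSp _).quadForm_nonneg v) hSs, ← ENNReal.ofReal_add hterm0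
      (tsum_nonneg fun c => (hSp _).quadForm_nonneg v),
      ENNReal.ofReal_le_ofReal_iff ((hSp I).quadForm_nonneg v)] at hSle
    exact hSle
  have hu := hW.integrableOn_sqrt_toEuclideanLin I hg
  have hsumf : HasSum (fun c : I.Children =>
      2 * (σ.real (I.child c).set * RCLike.re (inner 𝕜 (f (I.child c)) v)))
      (2 * (σ.real I.set * RCLike.re (inner 𝕜 (f I) v))) := by
    have h1 := hasSum_setIntegral_child I (hu.inner_const (𝕜 := 𝕜) v).re
    refine (HasSum.mul_left 2 ?_)
    simp_rw [hf]
    rw [real_mul_re_inner_setAverage hu I.measure_ne_top]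
    refine h1.congr_fun ?_
    intro c
    rw [real_mul_re_inner_setAverage (hW.integrableOn_sqrt_toEuclideanLin _ hg)
      (I.child c).measure_ne_top]
  have hsumV : HasSum (fun c : I.Children => σ.real (I.child c).set *
      quadForm (matrixAvg σ W (I.child c).set) v)
      (σ.real I.set * quadForm (matrixAvg σ W I.set) v) := by
    simp_rw [real_mul_quadForm_matrixAvg hW]
    exact hasSum_setIntegral_child I (hW.integrableOn_quadForm I v)
  have hsumε : HasSum (fun c : I.Children => σ.real (I.child c).set * (ε * ‖v‖ ^ 2))
      (σ.real I.set * (ε * ‖v‖ ^ 2)) := by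
    have h1 := hasSum_setIntegral_child I (h := fun _ => ε * ‖v‖ ^ 2)
      (integrableOn_const I.measure_ne_top)
    simpa using h1
  have hsumT : HasSum (fun c : I.Children => σ.real (I.child c).set * quadForm (T (I.child c)) v)
      (σ.real I.set * quadForm (matrixAvg σ W I.set) v + σ.real I.set * (ε * ‖v‖ ^ 2) +
        t * ∑' c : I.Children, quadForm (S (I.child c)) v) := by
    simp_rw [hT]
    exact (hsumV.add hsumε).add (hSs.hasSum.mul_left t)
  -- The variational inequality summed over the children. Averages of `f`, `⟨W⟩` and `ε` add up
  -- exactly, while `S_I` exceeds the sum over the children by at least the Carleson term; that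
  -- excess is the gain.
  have hcmp := hasSum_le (fun c : I.Children => ?_) hsumf (hφs.hasSum.add hsumT)
  · have h1 : σ.real I.set * RCLike.re (inner 𝕜 (f I) v) = σ.real I.set * quadForm (T I) v := by
      rw [hv, hzq]
    rw [hT] at h1
    have h2 := mul_le_mul_of_nonneg_left hSle' ht
    rw [← ENNReal.ofReal_tsum_of_nonneg (fun c => hφ0 _) hφs, ← ENNReal.ofReal_add (hφ0 I)
      (mul_nonneg ht hterm0)]
    refine ENNReal.ofReal_le_ofReal ?_
    linarith
  · have h1 := mul_le_mul_of_nonneg_left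
      ((hTp (I.child c)).two_mul_re_inner_le (hz (I.child c)) v)
      (measureReal_nonneg (μ := σ) (s := (I.child c).set))
    linarith

/-- The total gain of the Bellman function is at most the norm of `g`. -/
theorem tsum_gain_le (hW : IsMatrixWeight 𝓓 W)
    {S : 𝓓.Atom → Matrix (Fin d) (Fin d) 𝕜} (hSp : ∀ I, (S I).PosSemidef)
    (hS : ∀ I v, subSum (carlesonTerm W A v) I = ENNReal.ofReal (quadForm (S I) v))
    {g : X → EuclideanSpace 𝕜 (Fin d)} (hg : MemLp g 2 σ)
    {f : 𝓓.Atom → EuclideanSpace 𝕜 (Fin d)}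
    (hf : ∀ I, f I = ⨍ x in I.set, (CFC.sqrt (W x)).toEuclideanLin (g x) ∂σ)
    {ε t : ℝ} (hε : 0 ≤ ε) (ht : 0 ≤ t) {T : 𝓓.Atom → Matrix (Fin d) (Fin d) 𝕜}
    {z : 𝓓.Atom → EuclideanSpace 𝕜 (Fin d)} (hTp : ∀ I, (T I).PosSemidef)
    (hT : ∀ I v, σ.real I.set * quadForm (T I) v =
      σ.real I.set * quadForm (matrixAvg σ W I.set) v + σ.real I.set * (ε * ‖v‖ ^ 2) +
        t * quadForm (S I) v)
    (hz : ∀ I, (T I).toEuclideanLin (z I) = f I) :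
    ∑' I, ENNReal.ofReal (t * (σ.real I.set * ‖(CFC.sqrt (A I)).toEuclideanLin
        ((matrixAvg σ W I.set).toEuclideanLin (z I))‖ ^ 2)) ≤ eLpNorm g 2 σ ^ 2 := by
  have hg2 : Integrable (fun x => ‖g x‖ ^ 2) σ := (memLp_two_iff_integrable_sq_norm hg.1).1 hg
  have hφ (I : 𝓓.Atom) :
      σ.real I.set * RCLike.re (inner 𝕜 (f I) (z I)) ≤ ∫ x in I.set, ‖g x‖ ^ 2 ∂σ := by
    have h1 := real_mul_two_mul_re_inner_le hW I hg (z I)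
    rw [← hf] at h1
    have h2 : σ.real I.set * RCLike.re (inner 𝕜 (f I) (z I)) =
        σ.real I.set * quadForm (T I) (z I) := by
      rw [← hz, quadForm]
    have h3 := hT I (z I)
    have h4 : 0 ≤ σ.real I.set * (ε * ‖z I‖ ^ 2) :=
      mul_nonneg measureReal_nonneg (by positivity)
    have h5 : 0 ≤ t * quadForm (S I) (z I) := mul_nonneg ht ((hSp I).quadForm_nonneg _)
    linarith
  refine tsum_atom_le_of_step
    (φ := fun I => ENNReal.ofReal (σ.real I.set * RCLike.re (inner 𝕜 (f I) (z I))))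
    (fun I hI => by simp [hI]) (bellman_step hW hSp hS hg hf ht hTp hT hz hφ) fun n => ?_
  have h1 := lintegral_iUnion (μ := σ) (fun s : 𝓓.D n => measurableSet_of_mem s.2)
    (pairwise_disjoint_coe n) fun x => ENNReal.ofReal (‖g x‖ ^ 2)
  rw [iUnion_coe, Measure.restrict_univ, ← eLpNorm_two_sq_eq_lintegral] at h1
  rw [h1]
  refine ENNReal.tsum_le_tsum fun s => ?_
  refine (ENNReal.ofReal_le_ofReal (hφ (𝓓.atomOf n s))).trans (le_of_eq ?_)
  exact ofReal_integral_eq_lintegral_ofReal hg2.integrableOn (ae_of_all _ fun x => by positivity)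

/-- The embedding with the averages regularised. -/
theorem MatrixCarleson.exists_regularized (hW : IsMatrixWeight 𝓓 W)
    (hA : ∀ I, (A I).PosSemidef) {b : ℝ≥0} (hb : 0 < b) (hd : 0 < d) (h : MatrixCarleson 𝓓 W A b)
    {g : X → EuclideanSpace 𝕜 (Fin d)} (hg : MemLp g 2 σ) {ε : ℝ} (hε : 0 < ε) :
    ∃ y : 𝓓.Atom → EuclideanSpace 𝕜 (Fin d),
      (∀ I, (matrixAvg σ W I.set + ε • (1 : Matrix (Fin d) (Fin d) 𝕜)).toEuclideanLin (y I) =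
        ⨍ x in I.set, (CFC.sqrt (W x)).toEuclideanLin (g x) ∂σ) ∧
      ∀ F : Finset 𝓓.Atom, ∑ I ∈ F, σ.real I.set * ‖(CFC.sqrt (A I)).toEuclideanLin
        ((matrixAvg σ W I.set).toEuclideanLin (y I))‖ ^ 2 ≤
          Real.exp 1 * (d : ℝ) ^ 3 * ((d : ℝ) + 1) ^ 2 * b * (eLpNorm g 2 σ ^ 2).toReal := by
  obtain ⟨S, hSp, hS, hSb⟩ := h.exists_sum hW hA
  have hd' : (0 : ℝ) < d := by exact_mod_cast hd
  have hb' : (0 : ℝ) < b := by exact_mod_cast hb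
  -- Chosen so that `κ |I|⁻¹ S_I ≤ (2d)⁻¹ ⟨W⟩_I`, the eigenvalue bound required by
  -- `norm_sum_sq_le_integral`.
  set κ : ℝ := 1 / (2 * d * b) with hκ
  have hκ0 : 0 < κ := by positivity
  set f : 𝓓.Atom → EuclideanSpace 𝕜 (Fin d) := fun I =>
    ⨍ x in I.set, (CFC.sqrt (W x)).toEuclideanLin (g x) ∂σ with hf
  set T₀ : 𝓓.Atom → Matrix (Fin d) (Fin d) 𝕜 := fun I =>
    matrixAvg σ W I.set + ε • (1 : Matrix (Fin d) (Fin d) 𝕜) with hT₀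
  set M : 𝓓.Atom → Matrix (Fin d) (Fin d) 𝕜 := fun I => (κ * (σ.real I.set)⁻¹) • S I with hM
  have hκI (I : 𝓓.Atom) : 0 ≤ κ * (σ.real I.set)⁻¹ :=
    mul_nonneg hκ0.le (inv_nonneg.2 measureReal_nonneg)
  have hT₀p (I : 𝓓.Atom) : (T₀ I).PosDef := posDef_add_smul_one (hW.posSemidef_matrixAvg I) hε
  have hMp (I : 𝓓.Atom) : (M I).PosSemidef := (hSp I).real_smul (hκI I)
  have hT₀q (I : 𝓓.Atom) (v : EuclideanSpace 𝕜 (Fin d)) :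
      quadForm (T₀ I) v = quadForm (matrixAvg σ W I.set) v + ε * ‖v‖ ^ 2 := by
    rw [hT₀, quadForm_add, quadForm_smul, quadForm_one]
  have hMq (I : 𝓓.Atom) (v : EuclideanSpace 𝕜 (Fin d)) :
      σ.real I.set * quadForm (M I) v = κ * quadForm (S I) v := by
    rw [hM, quadForm_smul]
    -- On a null atom the left side is `0`, and `hSb` makes the form of `S_I` vanish as well.
    rcases (measureReal_nonneg (μ := σ) (s := I.set)).eq_or_lt with h0 | h0
    · have h1 := hSb I v
      rw [← h0, zero_mul, mul_zero] at h1
      rw [le_antisymm h1 ((hSp I).quadForm_nonneg v)]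
      simp
    · field_simp
  have hMT (I : 𝓓.Atom) (v : EuclideanSpace 𝕜 (Fin d)) :
      quadForm (M I) v ≤ 1 / (2 * d) * quadForm (T₀ I) v := by
    have hV := (hW.posSemidef_matrixAvg I).quadForm_nonneg v
    have h1 : quadForm (M I) v ≤ 1 / (2 * d) * quadForm (matrixAvg σ W I.set) v := by
      rcases (measureReal_nonneg (μ := σ) (s := I.set)).eq_or_lt with h0 | h0
      · rw [hM, quadForm_smul, ← h0]
        simp only [inv_zero, mul_zero, zero_mul]
        positivity
      · refine le_of_mul_le_mul_left ?_ h0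
        rw [hMq]
        refine (mul_le_mul_of_nonneg_left (hSb I v) hκ0.le).trans (le_of_eq ?_)
        rw [hκ]
        field_simp
    refine h1.trans (mul_le_mul_of_nonneg_left ?_ (by positivity))
    rw [hT₀q]
    have : 0 ≤ ε * ‖v‖ ^ 2 := by positivity
    linarith
  choose e μ hμ0 hμ1 hsol using fun I => (hT₀p I).exists_pencil_solution (hMp I) (hMT I) (f I)
  set z : ℝ → 𝓓.Atom → EuclideanSpace 𝕜 (Fin d) := fun s I =>
    ∑ i, (((1 + s * μ I i)⁻¹ : ℝ) : 𝕜) • e I i with hz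
  set L : 𝓓.Atom → EuclideanSpace 𝕜 (Fin d) →ₗ[𝕜] EuclideanSpace 𝕜 (Fin d) := fun I =>
    (CFC.sqrt (A I)).toEuclideanLin ∘ₗ (matrixAvg σ W I.set).toEuclideanLin with hL
  have hLz (s : ℝ) (I : 𝓓.Atom) :
      L I (z s I) = ∑ i, (((1 + s * μ I i)⁻¹ : ℝ) : 𝕜) • L I (e I i) := by
    simp only [hz, map_sum, map_smul]
  set G : ℝ := (eLpNorm g 2 σ ^ 2).toReal with hG
  have hGtop : eLpNorm g 2 σ ^ 2 ≠ ∞ := (ENNReal.pow_lt_top hg.2).ne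
  have hgain (F : Finset 𝓓.Atom) {s : ℝ} (hs : 0 ≤ s) :
      ∑ I ∈ F, σ.real I.set * (s * ‖L I (z s I)‖ ^ 2) ≤ κ⁻¹ * G := by
    have h1 := tsum_gain_le (A := A) (T := fun I => T₀ I + s • M I) (z := z s) (f := f)
      (ε := ε) (t := s * κ) hW hSp hS hg (fun I => rfl) hε.le (mul_nonneg hs hκ0.le)
      (fun I => (hT₀p I).posSemidef.add ((hMp I).real_smul hs)) (fun I v => by
        rw [quadForm_add, quadForm_smul, mul_add, hT₀q, mul_left_comm, hMq]
        ring) (fun I => hsol I s hs)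
    have h2 := (ENNReal.sum_le_tsum F).trans h1
    rw [← ENNReal.ofReal_sum_of_nonneg fun I _ => mul_nonneg (mul_nonneg hs hκ0.le)
      (mul_nonneg measureReal_nonneg (sq_nonneg _)), ENNReal.ofReal_le_iff_le_toReal hGtop] at h2
    rw [inv_mul_eq_div, le_div_iff₀ hκ0, Finset.sum_mul]
    refine le_trans (le_of_eq (Finset.sum_congr rfl fun I _ => ?_)) h2
    simp only [hL, LinearMap.comp_apply]
    ring
  have hcont (I : 𝓓.Atom) : ContinuousOn (fun s : ℝ => s * ‖L I (z s I)‖ ^ 2) (Set.Icc 0 1) := by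
    simp_rw [hLz]
    refine continuousOn_id.mul (ContinuousOn.pow (ContinuousOn.norm ?_) 2)
    refine continuousOn_finsetSum _ fun i _ => ?_
    have h1 : ContinuousOn (fun s : ℝ => (((1 + s * μ I i)⁻¹ : ℝ) : 𝕜)) (Set.Icc 0 1) := by
      refine RCLike.continuous_ofReal.comp_continuousOn ?_
      refine ContinuousOn.inv₀ (by fun_prop) fun s hs => ?_
      have := mul_nonneg hs.1 (hμ0 I i)
      linarith
    exact h1.smul continuousOn_const
  have hint (I : 𝓓.Atom) :
      IntervalIntegrable (fun s : ℝ => s * ‖L I (z s I)‖ ^ 2) volume 0 1 :=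
    ContinuousOn.intervalIntegrable (by
      rw [Set.uIcc_of_le zero_le_one]
      exact hcont I)
  set K : ℝ := Real.exp 1 * ((d : ℝ) ^ 2 * ((d : ℝ) + 1) ^ 2 / 2) with hK
  have hK0 : 0 ≤ K := by positivity
  refine ⟨z 0, fun I => ?_, fun F => ?_⟩
  · have h1 := hsol I 0 le_rfl
    rwa [zero_smul, add_zero] at h1
  · have h1 (I : 𝓓.Atom) : ‖L I (z 0 I)‖ ^ 2 ≤
        K * ∫ s in (0 : ℝ)..1, s * ‖L I (z s I)‖ ^ 2 := by
      have h2 := norm_sum_sq_le_integral (𝕜 := 𝕜) (fun i => L I (e I i)) (hμ0 I) (hμ1 I)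
      have h3 : L I (z 0 I) = ∑ i, L I (e I i) := by
        rw [hLz]
        simp
      rw [h3]
      simp_rw [hLz]
      exact h2
    -- The weight `s` in the integral is exactly the factor by which the gain degenerates at `s =
    -- 0`, so the integrand is bounded by `κ⁻¹ G` uniformly on `[0, 1]`.
    calc ∑ I ∈ F, σ.real I.set * ‖L I (z 0 I)‖ ^ 2
        ≤ ∑ I ∈ F, σ.real I.set * (K * ∫ s in (0 : ℝ)..1, s * ‖L I (z s I)‖ ^ 2) :=
          Finset.sum_le_sum fun I _ => mul_le_mul_of_nonneg_left (h1 I) measureReal_nonneg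
      _ = K * ∫ s in (0 : ℝ)..1, ∑ I ∈ F, σ.real I.set * (s * ‖L I (z s I)‖ ^ 2) := by
          rw [intervalIntegral.integral_finsetSum fun I _ => (hint I).const_mul _, Finset.mul_sum]
          refine Finset.sum_congr rfl fun I _ => ?_
          rw [intervalIntegral.integral_const_mul]
          ring
      _ ≤ K * ∫ _s in (0 : ℝ)..1, κ⁻¹ * G := by
          refine mul_le_mul_of_nonneg_left ?_ hK0
          refine intervalIntegral.integral_mono_on zero_le_one
            (ContinuousOn.intervalIntegrable ?_)
            intervalIntegrable_const fun s hs => hgain F hs.1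
          rw [Set.uIcc_of_le zero_le_one]
          exact continuousOn_finsetSum F fun I _ => continuousOn_const.mul (hcont I)
      _ = _ := by
          rw [intervalIntegral.integral_const, sub_zero, one_smul, hK, hκ]
          field_simp

theorem MatrixCarleson.unweightedEmbedding (hW : IsMatrixWeight 𝓓 W)
    (hA : ∀ I, (A I).PosSemidef) {a b : ℝ≥0} (hb : 0 < b)
    (ha : (a : ℝ) = Real.exp 1 * (d : ℝ) ^ 3 * ((d : ℝ) + 1) ^ 2 * b)
    (h : MatrixCarleson 𝓓 W A b) : UnweightedEmbedding 𝓓 W A a := by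
  intro g hg
  rcases Nat.eq_zero_or_pos d with rfl | hd
  · have h0 : embeddingSum 𝓓 (fun x => CFC.sqrt (W x)) A g = 0 := by
      rw [embeddingSum, ENNReal.tsum_eq_zero]
      intro I
      rw [Subsingleton.elim (⨍ x in I.set, (CFC.sqrt (W x)).toEuclideanLin (g x) ∂σ) 0]
      simp
    rw [h0]
    exact zero_le
  have hGtop : eLpNorm g 2 σ ^ 2 ≠ ∞ := (ENNReal.pow_lt_top hg.2).ne
  set ε : ℕ → ℝ := fun n => 1 / ((n : ℝ) + 1) with hε
  have hε0 (n : ℕ) : 0 < ε n := by positivity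
  have hεt : Tendsto ε atTop (𝓝 0) := tendsto_one_div_add_atTop_nhds_zero_nat
  choose y hy hsum using fun n => h.exists_regularized hW hA hb hd hg (hε0 n)
  have hlim (I : 𝓓.Atom) : Tendsto (fun n => (matrixAvg σ W I.set).toEuclideanLin (y n I)) atTop
      (𝓝 (⨍ x in I.set, (CFC.sqrt (W x)).toEuclideanLin (g x) ∂σ)) := by
    -- Some finite bound depending on `I` is enough, since it is multiplied by `ε_n → 0`. On a null
    -- atom the average is `0`, so `G = 0` works.
    obtain ⟨G, hG⟩ : ∃ G : ℝ, ∀ v, 2 * RCLike.re (inner 𝕜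
        (⨍ x in I.set, (CFC.sqrt (W x)).toEuclideanLin (g x) ∂σ) v) ≤
          G + quadForm (matrixAvg σ W I.set) v := by
      rcases (measureReal_nonneg (μ := σ) (s := I.set)).eq_or_lt with h0 | h0
      · refine ⟨0, fun v => ?_⟩
        rw [setAverage_eq, ← h0]
        simpa using (hW.posSemidef_matrixAvg I).quadForm_nonneg v
      · refine ⟨(σ.real I.set)⁻¹ * ∫ x in I.set, ‖g x‖ ^ 2 ∂σ, fun v => ?_⟩
        refine le_of_mul_le_mul_left ?_ h0
        rw [mul_add, mul_inv_cancel_left₀ h0.ne']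
        exact real_mul_two_mul_re_inner_le hW I hg v
    rw [tendsto_iff_norm_sub_tendsto_zero]
    have h1 : Tendsto (fun n => √(ε n * G)) atTop (𝓝 0) := by
      have := (hεt.mul_const G).sqrt
      simpa using this
    refine squeeze_zero (fun n => norm_nonneg _) (fun n => ?_) h1
    rw [norm_sub_rev]
    exact Real.le_sqrt_of_sq_le (norm_sub_sq_le_of_regularized (hε0 n).le hG (hy n I))
  rw [embeddingSum, ENNReal.tsum_eq_iSup_sum]
  refine iSup_le fun F => ?_
  have hterm (I : 𝓓.Atom) : ‖(CFC.sqrt (A I)).toEuclideanLin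
      (⨍ x in I.set, (CFC.sqrt (W x)).toEuclideanLin (g x) ∂σ)‖ₑ ^ 2 * σ I.set =
      ENNReal.ofReal (σ.real I.set * ‖(CFC.sqrt (A I)).toEuclideanLin
        (⨍ x in I.set, (CFC.sqrt (W x)).toEuclideanLin (g x) ∂σ)‖ ^ 2) :=
    enorm_sq_mul_measure _ I.measure_ne_top
  simp_rw [hterm]
  rw [← ENNReal.ofReal_sum_of_nonneg fun I _ => mul_nonneg measureReal_nonneg (sq_nonneg _)]
  have hle : ∑ I ∈ F, σ.real I.set * ‖(CFC.sqrt (A I)).toEuclideanLin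
      (⨍ x in I.set, (CFC.sqrt (W x)).toEuclideanLin (g x) ∂σ)‖ ^ 2 ≤
        a * (eLpNorm g 2 σ ^ 2).toReal := by
    rw [ha]
    refine le_of_tendsto (x := atTop) (tendsto_finsetSum F fun I _ => ?_)
      (Eventually.of_forall fun n => hsum n F)
    refine Tendsto.const_mul _ (Tendsto.pow (Tendsto.norm ?_) 2)
    exact ((LinearMap.continuous_of_finiteDimensional _).tendsto _).comp (hlim I)
  refine (ENNReal.ofReal_le_ofReal hle).trans (le_of_eq ?_)
  rw [ENNReal.ofReal_mul a.coe_nonneg, ENNReal.ofReal_coe_nnreal, ENNReal.ofReal_toReal hGtop]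

/-- A nonempty family of inequalities linear in a constant has a smallest constant. -/
theorem exists_isLeast_of_forall_le_mul {ι : Type*} {P : ℝ≥0 → Prop} {x y : ι → ℝ≥0∞}
    (hy : ∀ i, y i ≠ ∞) (hP : ∀ a, P a ↔ ∀ i, x i ≤ a * y i) (hne : ∃ a, P a) :
    ∃ a, IsLeast {a | P a} a := by
  refine ⟨sInf {a | P a}, (IsClosed.csInf_mem ?_ hne (OrderBot.bddBelow _)), fun a ha =>
    csInf_le (OrderBot.bddBelow _) ha⟩
  have : {a | P a} = ⋂ i, {a : ℝ≥0 | x i ≤ a * y i} := by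
    ext a
    simp [hP]
  rw [this]
  refine isClosed_iInter fun i => isClosed_le continuous_const ?_
  exact (ENNReal.continuous_mul_const (hy i)).comp ENNReal.continuous_coe

end CarlesonEmbedding

/-! ### The equivalence and the comparison of smallest constants. -/

theorem theorem1p2 {X : Type*} [MeasurableSpace X] (σ : Measure X) [SigmaFinite σ]
    (𝓓 : AtomicFiltration σ) {𝕜 : Type*} [RCLike 𝕜] (d : ℕ)
    (W : X → Matrix (Fin d) (Fin d) 𝕜) (hW : IsMatrixWeight 𝓓 W)
    (A : 𝓓.Atom → Matrix (Fin d) (Fin d) 𝕜) (hA : ∀ I, (A I).PosSemidef) :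
    List.TFAE [∃ a : ℝ≥0, UnweightedEmbedding 𝓓 W A a,
      ∃ a : ℝ≥0, WeightedEmbedding 𝓓 W A a,
      ∃ b : ℝ≥0, MatrixCarleson 𝓓 W A b] ∧
    ((∃ b : ℝ≥0, MatrixCarleson 𝓓 W A b) →
      ∃ a b : ℝ≥0, IsLeast {a : ℝ≥0 | UnweightedEmbedding 𝓓 W A a} a ∧
        IsLeast {a : ℝ≥0 | WeightedEmbedding 𝓓 W A a} a ∧
        IsLeast {b : ℝ≥0 | MatrixCarleson 𝓓 W A b} b ∧
        (b : ℝ) ≤ a ∧ (a : ℝ) ≤ Real.exp 1 * (d : ℝ) ^ 3 * ((d : ℝ) + 1) ^ 2 * b) := by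
  have h12 (a : ℝ≥0) : UnweightedEmbedding 𝓓 W A a ↔ WeightedEmbedding 𝓓 W A a :=
    ⟨fun h => h.weightedEmbedding hW, fun h => h.unweightedEmbedding hW⟩
  have hmono {b b' : ℝ≥0} (hbb : b ≤ b') (h : MatrixCarleson 𝓓 W A b) :
      MatrixCarleson 𝓓 W A b' := by
    rw [matrixCarleson_iff hW hA] at h ⊢
    exact fun I v => (h I v).trans (by gcongr)
  set C : ℝ≥0 := ⟨Real.exp 1 * (d : ℝ) ^ 3 * ((d : ℝ) + 1) ^ 2, by positivity⟩ with hC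
  -- Passing to a strictly larger `b'` ensures positivity, since `κ` involves division by the
  -- Carleson constant. The sharp inequality is recovered below by letting `b'` decrease to `b`.
  have h31 {b b' : ℝ≥0} (hbb : b < b') (h : MatrixCarleson 𝓓 W A b) :
      UnweightedEmbedding 𝓓 W A (C * b') :=
    (hmono hbb.le h).unweightedEmbedding hW hA (bot_le.trans_lt hbb) rfl
  constructor
  · tfae_have 1 ↔ 2 := exists_congr h12
    tfae_have 1 → 3 := fun ⟨a, ha⟩ => ⟨a, ha.matrixCarleson hW hA⟩
    tfae_have 3 → 1 := fun ⟨b, hb⟩ => ⟨_, h31 (lt_add_one b) hb⟩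
    tfae_finish
  · rintro ⟨b₀, hb₀⟩
    obtain ⟨b, hb⟩ := exists_isLeast_of_forall_le_mul
      (ι := 𝓓.Atom × EuclideanSpace 𝕜 (Fin d)) (P := MatrixCarleson 𝓓 W A)
      (x := fun p => AtomicFiltration.subSum (carlesonTerm W A p.2) p.1)
      (y := fun p => ENNReal.ofReal (σ.real p.1.set * quadForm (matrixAvg σ W p.1.set) p.2))
      (fun _ => ENNReal.ofReal_ne_top)
      (fun b => (matrixCarleson_iff hW hA b).trans
        ⟨fun h p => h p.1 p.2, fun h I v => h (I, v)⟩) ⟨b₀, hb₀⟩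
    obtain ⟨a, ha⟩ := exists_isLeast_of_forall_le_mul
      (ι := {f : X → EuclideanSpace 𝕜 (Fin d) // MemLp f 2 σ}) (P := UnweightedEmbedding 𝓓 W A)
      (x := fun f => embeddingSum 𝓓 (fun x => CFC.sqrt (W x)) A f.1)
      (y := fun f => eLpNorm f.1 2 σ ^ 2) (fun f => (ENNReal.pow_lt_top f.2.2).ne)
      (fun a => ⟨fun h f => h f.1 f.2, fun h f hf => h ⟨f, hf⟩⟩) ⟨_, h31 (lt_add_one b₀) hb₀⟩
    refine ⟨a, b, ha, ?_, hb, ?_, ?_⟩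
    · simpa only [h12] using ha
    · exact_mod_cast hb.2 (ha.1.matrixCarleson hW hA)
    · have h1 : a ≤ C * b := by
        have h2 : Filter.Tendsto (fun b' => C * b') (nhdsWithin b (Set.Ioi b)) (nhds (C * b)) :=
          ((continuous_const.mul continuous_id).tendsto b).mono_left nhdsWithin_le_nhds
        refine ge_of_tendsto h2 ?_
        filter_upwards [self_mem_nhdsWithin] with b' hb'
        exact ha.2 (h31 hb' hb.1)
      exact NNReal.coe_le_coe.2 h1
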